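/- Let $X$ be a normal complex variety (an integral separated scheme of finite type over $\mathbb{C}$ with integrally closed local rings), let $n \ge 0$ and let $[p_1],\dots,[p_n]$ be classes in $H^1(X,\mathbb{G}_m)$ (Čech cohomology for the Zariski topology). Let $\mathbb{T}^n=\mathbb{G}_m^n$ and let $p\colon P\to X$ be a (Zariski locally trivial) principal homogeneous $\mathbb{T}^n$-bundle with class $([p_1],\dots,[p_n])\in H^1(X,\mathbb{T}^n)=H^1(X,\mathbb{G}_m)^{\oplus n}$. Let $G=\langle [p_1],\dots,[p_n]\rangle$ be the subgroup of $H^1(X,\mathbb{G}_m)$ generated by $[p_1],\dots,[p_n]$. Then the pull-back homomorphism $p^*\colon H^1(X,\mathbb{G}_m)\to H^1(P,\mathbb{G}_m)$ induces a group isomorphism $$H^1(X,\mathbb{G}_m)/G\;\xrightarrow{\ \sim\ }\;H^1(P,\mathbb{G}_m),$$ that is, $\mathrm{Pic}(P)\simeq \mathrm{Pic}(X)/G$. -/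

import Mathlib

open CategoryTheory AlgebraicGeometry MonoidalCategory CartesianMonoidalCategory
open scoped MonObj

noncomputable section

namespace TorusBundle

universe u

/-! ### The Čech cohomology group `Ȟ¹(X, 𝔾ₘ)` -/

section Cech

/-- The restriction homomorphism `𝒪(U)ˣ → 𝒪(V)ˣ` of the sheaf `𝔾ₘ` of invertible functions. -/
def resUnits (X : Scheme.{u}) {U V : X.Opens} (h : V ≤ U) : Γ(X, U)ˣ →* Γ(X, V)ˣ :=
  Units.map (X.presheaf.map (homOfLE h).op).hom

lemma resUnits_self (X : Scheme.{u}) {U : X.Opens} (h : U ≤ U) (a : Γ(X, U)ˣ) :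
    resUnits X h a = a := by
  ext
  simp [resUnits]

lemma resUnits_resUnits (X : Scheme.{u}) {U V W : X.Opens} (h : V ≤ U) (h' : W ≤ V)
    (a : Γ(X, U)ˣ) : resUnits X h' (resUnits X h a) = resUnits X (h'.trans h) a := by
  ext
  have : homOfLE (h'.trans h) = homOfLE h' ≫ homOfLE h := rfl
  simp only [resUnits, Units.coe_map, MonoidHom.coe_coe, this, op_comp, Functor.map_comp,
    CommRingCat.hom_comp, RingHom.comp_apply]

/-- Pull-back of invertible functions `𝒪_X(U)ˣ → 𝒪_Y(V)ˣ` along `f : Y ⟶ X`, for `V ⊆ f⁻¹(U)`. -/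
def pullUnits {X Y : Scheme.{u}} (f : Y ⟶ X) {U : X.Opens} {V : Y.Opens} (h : V ≤ f ⁻¹ᵁ U) :
    Γ(X, U)ˣ →* Γ(Y, V)ˣ :=
  Units.map (f.appLE U V h).hom

lemma pullUnits_resUnits {X Y : Scheme.{u}} (f : Y ⟶ X) {U U' : X.Opens} {V : Y.Opens}
    (h : U' ≤ U) (h' : V ≤ f ⁻¹ᵁ U') (a : Γ(X, U)ˣ) :
    pullUnits f h' (resUnits X h a) = pullUnits f (h'.trans (f.preimage_mono h)) a := by
  ext
  exact congr($(f.map_appLE h' (homOfLE h).op) a.val)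

lemma resUnits_pullUnits {X Y : Scheme.{u}} (f : Y ⟶ X) {U : X.Opens} {V V' : Y.Opens}
    (h : V ≤ f ⁻¹ᵁ U) (h' : V' ≤ V) (a : Γ(X, U)ˣ) :
    resUnits Y h' (pullUnits f h a) = pullUnits f (h'.trans h) a := by
  ext
  exact congr($(f.appLE_map h (homOfLE h').op) a.val)

/-- An open cover of `X` indexed by the points of `X`, the open set with index `x` containing `x`.
Every open cover of `X` is refined by such a cover, so that these covers are cofinal among all
open covers and suffice to compute Čech cohomology. -/
structure PtCover (X : Scheme.{u}) where
  /-- the open set with index `x` -/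
  opens : X → X.Opens
  mem : ∀ x, x ∈ opens x

/-- `𝒰 ≤ 𝒱` means that `𝒱` is a refinement of `𝒰`. -/
instance (X : Scheme.{u}) : Preorder (PtCover X) where
  le 𝒰 𝒱 := ∀ x, 𝒱.opens x ≤ 𝒰.opens x
  le_refl _ _ := le_rfl
  le_trans _ _ _ h h' x := (h' x).trans (h x)

instance (X : Scheme.{u}) : Nonempty (PtCover X) :=
  ⟨⟨fun _ => ⊤, fun _ => trivial⟩⟩

instance (X : Scheme.{u}) : IsDirectedOrder (PtCover X) where
  directed 𝒰 𝒱 := ⟨⟨fun x => 𝒰.opens x ⊓ 𝒱.opens x, fun x => ⟨𝒰.mem x, 𝒱.mem x⟩⟩,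
    fun _ => inf_le_left, fun _ => inf_le_right⟩

variable {X : Scheme.{u}} (𝒰 : PtCover X)

/-- Čech `0`-cochains. -/
abbrev C0 : Type u := ∀ x, Γ(X, 𝒰.opens x)ˣ

/-- Čech `1`-cochains. -/
abbrev C1 : Type u := ∀ x y, Γ(X, 𝒰.opens x ⊓ 𝒰.opens y)ˣ

/-- Čech `2`-cochains. -/
abbrev C2 : Type u := ∀ x y z, Γ(X, 𝒰.opens x ⊓ 𝒰.opens y ⊓ 𝒰.opens z)ˣ

/-- The Čech differential `(dc)_{xy} = c_y / c_x`. -/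
def d0 : C0 𝒰 →* C1 𝒰 where
  toFun c x y := resUnits X inf_le_right (c y) / resUnits X inf_le_left (c x)
  map_one' := by ext; simp
  map_mul' a b := by
    funext x y
    simp only [Pi.mul_apply, map_mul]
    exact mul_div_mul_comm _ _ _ _

/-- The Čech differential `(dg)_{xyz} = g_{yz} g_{xy} / g_{xz}`. -/
def d1 : C1 𝒰 →* C2 𝒰 where
  toFun g x y z :=
    resUnits X (le_inf (inf_le_left.trans inf_le_right) inf_le_right) (g y z) *
      resUnits X inf_le_left (g x y) /
      resUnits X (le_inf (inf_le_left.trans inf_le_left) inf_le_right) (g x z)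
  map_one' := by ext; simp
  map_mul' a b := by
    funext x y z
    simp only [Pi.mul_apply, map_mul]
    rw [mul_mul_mul_comm]
    exact mul_div_mul_comm _ _ _ _

/-- Čech `1`-cocycles. -/
abbrev Z1 : Subgroup (C1 𝒰) := (d1 𝒰).ker

/-- Čech `1`-coboundaries, as a subgroup of the group of `1`-cocycles. -/
abbrev B1 : Subgroup (Z1 𝒰) := (d0 𝒰).range.subgroupOf (Z1 𝒰)

/-- The Čech cohomology group `H¹(𝒰, 𝔾ₘ)` of the cover `𝒰`. -/
abbrev CoverH1 : Type u := Z1 𝒰 ⧸ B1 𝒰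

variable {𝒰} in
/-- Restriction of cocycles to a refinement. -/
def resZ1 {𝒱 : PtCover X} (h : 𝒰 ≤ 𝒱) : Z1 𝒰 →* Z1 𝒱 where
  toFun g := ⟨fun x y => resUnits X (inf_le_inf (h x) (h y)) (g.1 x y), by
    have hg := g.2
    rw [MonoidHom.mem_ker] at hg ⊢
    funext x y z
    have := congrArg (resUnits X (inf_le_inf (inf_le_inf (h x) (h y)) (h z)))
      (congrFun (congrFun (congrFun hg x) y) z)
    simpa [d1, resUnits_resUnits] using this⟩
  map_one' := by ext; simp
  map_mul' a b := by ext; simp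

variable {𝒰} in
/-- The restriction homomorphism `H¹(𝒰, 𝔾ₘ) → H¹(𝒱, 𝔾ₘ)` for a refinement `𝒱` of `𝒰`. -/
def resH1 (𝒰 𝒱 : PtCover X) (h : 𝒰 ≤ 𝒱) : CoverH1 𝒰 →* CoverH1 𝒱 :=
  QuotientGroup.map _ _ (resZ1 h) (by
    rintro g ⟨c, hc⟩
    refine ⟨fun x => resUnits X (h x) (c x), ?_⟩
    funext x y
    have hxy : d0 𝒰 c x y = g.1 x y := congrFun (congrFun hc x) y
    simp only [Subgroup.subtype_apply, resZ1, MonoidHom.coe_mk, OneHom.coe_mk, ← hxy]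
    simp [d0, resUnits_resUnits])

instance : DirectedSystem (fun 𝒰 : PtCover X => CoverH1 𝒰) (fun _ _ h => resH1 _ _ h) where
  map_self 𝒰 a := by
    induction a using QuotientGroup.induction_on with
    | H g =>
      refine congrArg (QuotientGroup.mk' (B1 𝒰)) (Subtype.ext ?_)
      funext x y
      exact resUnits_self X _ _
  map_map 𝒲 𝒱 𝒰 h h' a := by
    induction a using QuotientGroup.induction_on with
    | H g =>
      refine congrArg (QuotientGroup.mk' (B1 𝒲)) (Subtype.ext ?_)
      funext x y
      exact resUnits_resUnits X _ _ _

/-- `H¹(X, 𝔾ₘ)`, computed as Čech cohomology: the direct limit of the groups `H¹(𝒰, 𝔾ₘ)` over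
the open covers `𝒰` of `X`, ordered by refinement. -/
def H1 (X : Scheme.{u}) : Type u :=
  DirectLimit (fun 𝒰 : PtCover X => CoverH1 𝒰) (resH1 (X := X))

instance (X : Scheme.{u}) : CommGroup (H1 X) :=
  inferInstanceAs (CommGroup (DirectLimit (fun 𝒰 : PtCover X => CoverH1 𝒰) (resH1 (X := X))))

/-- The canonical homomorphism `H¹(𝒰, 𝔾ₘ) → H¹(X, 𝔾ₘ)`. -/
def H1.of : CoverH1 𝒰 →* H1 X where
  toFun a := Quotient.mk _ ⟨𝒰, a⟩
  map_one' := (DirectLimit.one_def (f := resH1 (X := X)) 𝒰).symm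
  map_mul' _ _ := (DirectLimit.mul_def (f := resH1 (X := X)) 𝒰 _ _).symm

variable {𝒰} in
lemma H1.of_resH1 {𝒱 : PtCover X} (h : 𝒰 ≤ 𝒱) (a : CoverH1 𝒰) :
    H1.of 𝒱 (resH1 𝒰 𝒱 h a) = H1.of 𝒰 a :=
  DirectLimit.mk_apply (f := resH1 (X := X)) 𝒰 𝒱 a h

/-- The class in `H¹(X, 𝔾ₘ)` of a cocycle on the cover `𝒰`. -/
def H1.mk : Z1 𝒰 →* H1 X := (H1.of 𝒰).comp (QuotientGroup.mk' (B1 𝒰))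

/-- A compatible family of homomorphisms on the groups `H¹(𝒰, 𝔾ₘ)` defines a homomorphism on
their direct limit `H¹(X, 𝔾ₘ)`. -/
def H1.lift {A : Type*} [CommGroup A] (F : ∀ 𝒰 : PtCover X, CoverH1 𝒰 →* A)
    (hF : ∀ 𝒰 𝒱 (h : 𝒰 ≤ 𝒱) a, F 𝒰 a = F 𝒱 (resH1 𝒰 𝒱 h a)) : H1 X →* A where
  toFun := DirectLimit.lift (resH1 (X := X)) (fun 𝒰 a => F 𝒰 a) hF
  map_one' := DirectLimit.lift_one (f := resH1 (X := X)) F hF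
  map_mul' := DirectLimit.lift_mul (f := resH1 (X := X)) F hF

/-- The cover of `Y` with members the inverse images `f⁻¹(𝒰 (f y))`. -/
def PtCover.comap {X Y : Scheme.{u}} (f : Y ⟶ X) (𝒰 : PtCover X) : PtCover Y where
  opens y := f ⁻¹ᵁ 𝒰.opens (f y)
  mem y := 𝒰.mem (f y)

lemma PtCover.comap_inf_le {X Y : Scheme.{u}} (f : Y ⟶ X) (𝒰 : PtCover X) (y y' : Y) :
    (𝒰.comap f).opens y ⊓ (𝒰.comap f).opens y' ≤
      f ⁻¹ᵁ (𝒰.opens (f y) ⊓ 𝒰.opens (f y')) :=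
  le_rfl

lemma PtCover.comap_le {X Y : Scheme.{u}} (f : Y ⟶ X) (𝒰 : PtCover X) (y : Y) :
    (𝒰.comap f).opens y ≤ f ⁻¹ᵁ 𝒰.opens (f y) :=
  le_rfl

/-- Pull-back of cocycles along `f`. -/
def pullZ1 {X Y : Scheme.{u}} (f : Y ⟶ X) (𝒰 : PtCover X) : Z1 𝒰 →* Z1 (𝒰.comap f) where
  toFun g := ⟨fun y y' => pullUnits f (𝒰.comap_inf_le f y y') (g.1 (f y) (f y')), by
    have hg := g.2
    rw [MonoidHom.mem_ker] at hg ⊢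
    funext x y z
    have hle : (𝒰.comap f).opens x ⊓ (𝒰.comap f).opens y ⊓ (𝒰.comap f).opens z ≤
      f ⁻¹ᵁ (𝒰.opens (f x) ⊓ 𝒰.opens (f y) ⊓ 𝒰.opens (f z)) := le_rfl
    have := congrArg (pullUnits f hle) (congrFun (congrFun (congrFun hg (f x)) (f y)) (f z))
    simpa [d1, pullUnits_resUnits, resUnits_pullUnits] using this⟩
  map_one' := by ext; simp
  map_mul' a b := by ext; simp

/-- The homomorphism `H¹(𝒰, 𝔾ₘ) → H¹(f⁻¹ 𝒰, 𝔾ₘ)`. -/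
def pullCoverH1 {X Y : Scheme.{u}} (f : Y ⟶ X) (𝒰 : PtCover X) :
    CoverH1 𝒰 →* CoverH1 (𝒰.comap f) :=
  QuotientGroup.map _ _ (pullZ1 f 𝒰) (by
    rintro g ⟨c, hc⟩
    refine ⟨fun y => pullUnits f (𝒰.comap_le f y) (c (f y)), ?_⟩
    funext y y'
    have hxy : d0 𝒰 c (f y) (f y') = g.1 (f y) (f y') := congrFun (congrFun hc _) _
    simp only [Subgroup.subtype_apply, pullZ1, MonoidHom.coe_mk, OneHom.coe_mk, ← hxy]
    simp [d0, pullUnits_resUnits, resUnits_pullUnits])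

/-- The pull-back homomorphism `f^* : H¹(X, 𝔾ₘ) → H¹(Y, 𝔾ₘ)` of a morphism `f : Y ⟶ X`. -/
def H1.pullback {X Y : Scheme.{u}} (f : Y ⟶ X) : H1 X →* H1 Y :=
  H1.lift (fun 𝒰 => (H1.of (𝒰.comap f)).comp (pullCoverH1 f 𝒰)) (by
    intro 𝒰 𝒱 h a
    have h' : 𝒰.comap f ≤ 𝒱.comap f := fun y => f.preimage_mono (h (f y))
    refine (H1.of_resH1 h' _).symm.trans (congrArg (H1.of (𝒱.comap f)) ?_)
    induction a using QuotientGroup.induction_on with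
    | H g =>
      refine congrArg (QuotientGroup.mk' (B1 (𝒱.comap f))) (Subtype.ext ?_)
      funext y y'
      exact (resUnits_pullUnits f _ _ _).trans (pullUnits_resUnits f _ _ _).symm)

end Cech

/-! ### Principal homogeneous `𝕋ⁿ`-bundles -/

/-- Schemes over `ℂ`. -/
abbrev SchC : Type 1 := Over (Spec (.of ℂ))

/-- The Laurent polynomial algebra `ℂ[t₁^±¹, …, tₙ^±¹]`, as the group algebra of `ℤⁿ`. -/
abbrev Laurent (n : ℕ) : Type := AddMonoidAlgebra ℂ (Fin n → ℤ)

/-- The torus `𝕋ⁿ = Spec ℂ[t₁^±¹, …, tₙ^±¹]` over `ℂ`. -/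
def Torus (n : ℕ) : SchC := (Spec (.of (Laurent n))).asOver (Spec (.of ℂ))

/-- The group structure of `𝕋ⁿ = 𝔾ₘⁿ`: it is given by the Hopf algebra structure of the group
algebra, in which the monomials, in particular the `tᵢ`, are group-like. -/
instance (n : ℕ) : GrpObj (Torus n) :=
  inferInstanceAs (GrpObj ((Spec (.of (Laurent n))).asOver (Spec (.of ℂ))))

/-- The coordinate function `tᵢ` on `𝕋ⁿ`. -/
def Torus.coord (n : ℕ) (i : Fin n) : Γ((Torus n).left, ⊤) :=
  (Scheme.ΓSpecIso (.of (Laurent n))).inv (AddMonoidAlgebra.single (Pi.single i 1) 1)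

open scoped MonoidalLeftAction in
/-- The morphism `𝕋ⁿ × P ⟶ P` of an action of the group scheme `𝕋ⁿ` on `P`. -/
abbrev actHom (n : ℕ) (P : SchC) [ModObj (Torus n) P] : Torus n ⊗ P ⟶ P := γ[Torus n, P]

/-- The open subscheme `U` of `X`, as a scheme over `ℂ`. -/
abbrev opn (X : SchC) (U : X.left.Opens) : SchC := Over.mk (U.ι ≫ X.hom)

/-- The inclusion of `U` in `X`. -/
abbrev opnι (X : SchC) (U : X.left.Opens) : opn X U ⟶ X := Over.homMk U.ι

/-- The inclusion of `V` in `U`. -/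
abbrev opnIncl (X : SchC) {U V : X.left.Opens} (h : V ≤ U) : opn X V ⟶ opn X U :=
  Over.homMk (X.left.homOfLE h) (by simp)

/-- The function `h^* tᵢ ∈ 𝒪(W)`, for a morphism `h : W ⟶ 𝕋ⁿ` defined on an open subset `W`. -/
def coordFun {n : ℕ} {X : SchC} {W : X.left.Opens} (h : opn X W ⟶ Torus n) (i : Fin n) :
    Γ(X.left, W) :=
  W.topIso.hom (h.left.appTop (Torus.coord n i))

/-- A trivialization over the open set `U` of a scheme `p : P ⟶ X` with `𝕋ⁿ`-action: a
`𝕋ⁿ`-equivariant isomorphism over `U` of `𝕋ⁿ × U` with `p⁻¹(U) = P ×_X U`. It is given by its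
composition `𝕋ⁿ × U ⟶ P` with the open immersion of `p⁻¹(U)` in `P`. -/
structure Trivialization (n : ℕ) {X P : SchC} [ModObj (Torus n) P] (p : P ⟶ X)
    (U : X.left.Opens) where
  /-- the morphism `𝕋ⁿ × U ⟶ P` -/
  hom : Torus n ⊗ opn X U ⟶ P
  equivariant : (μ[Torus n] ▷ opn X U) ≫ hom =
    (α_ (Torus n) (Torus n) (opn X U)).hom ≫ (Torus n ◁ hom) ≫ actHom n P
  isPullback : IsPullback hom (snd (Torus n) (opn X U)) p (opnι X U)

/-- `p : P ⟶ X` is a (Zariski locally trivial) principal homogeneous `𝕋ⁿ`-bundle: the action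
of `𝕋ⁿ` on `P` preserves `p`, and every point of `X` has an open neighbourhood `U` such that
`p⁻¹(U) ≃ 𝕋ⁿ × U` equivariantly over `U`. -/
structure IsPrincipalBundle (n : ℕ) {X P : SchC} [ModObj (Torus n) P] (p : P ⟶ X) : Prop where
  invariant : actHom n P ≫ p = snd (Torus n) P ≫ p
  locallyTrivial : ∀ x : X.left, ∃ U : X.left.Opens, x ∈ U ∧ Nonempty (Trivialization n p U)

/-- The trivializations `φ` over `U` and `ψ` over `V` differ over `U ∩ V` by the morphism
`h : U ∩ V ⟶ 𝕋ⁿ`, that is, `ψ(t, w) = φ(t h(w), w)`. -/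
def IsTransition {n : ℕ} {X P : SchC} [ModObj (Torus n) P] {p : P ⟶ X} {U V : X.left.Opens}
    (φ : Trivialization n p U) (ψ : Trivialization n p V) (h : opn X (U ⊓ V) ⟶ Torus n) : Prop :=
  (Torus n ◁ opnIncl X inf_le_right) ≫ ψ.hom =
    lift ((Torus n ◁ h) ≫ μ[Torus n]) (snd (Torus n) (opn X (U ⊓ V)) ≫ opnIncl X inf_le_left) ≫
      φ.hom

/-- The class of `p : P ⟶ X` in `H¹(X, 𝕋ⁿ) = H¹(X, 𝔾ₘ)^{⊕ n}` is `(c₁, …, cₙ)`: there are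
trivializations of `P` on the members of an open cover whose transition functions are given by the
`𝕋ⁿ`-valued cocycle `(g₁, …, gₙ)`, where the cocycle `gᵢ` represents `cᵢ`. -/
def HasClass {n : ℕ} {X P : SchC} [ModObj (Torus n) P] (p : P ⟶ X) (c : Fin n → H1 X.left) :
    Prop :=
  ∃ (𝒰 : PtCover X.left) (φ : ∀ x, Trivialization n p (𝒰.opens x)) (g : Fin n → Z1 𝒰),
    (∀ x y, ∃ h : opn X (𝒰.opens x ⊓ 𝒰.opens y) ⟶ Torus n,
      IsTransition (φ x) (φ y) h ∧ ∀ i, coordFun h i = ((g i).1 x y).1) ∧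
    ∀ i, H1.mk 𝒰 (g i) = c i

/-- A normal complex variety: an integral separated scheme of finite type over `ℂ`
all of whose local rings are integrally closed. -/
structure IsNormalVariety (X : SchC) : Prop where
  isIntegral : IsIntegral X.left
  isSeparated : IsSeparated X.hom
  locallyOfFiniteType : LocallyOfFiniteType X.hom
  quasiCompact : QuasiCompact X.hom
  isIntegrallyClosed : ∀ x : X.left, IsIntegrallyClosed (X.left.presheaf.stalk x)

end TorusBundle

end

/-!
The group `H¹(Y, 𝔾ₘ)` of an integral scheme `Y` is the group of Cartier divisors modulo principal
divisors: a cocycle becomes a coboundary over the constant sheaf of nonzero rational functions,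
and so it is given by the quotients of a family `D` of local equations (`divisorClass`). Over each
member `U` of a trivializing cover the bundle `P` has coordinates `t₁, …, tₙ`, and over an affine
open `V ⊆ U` the functions on `p⁻¹(V)` are the Laurent polynomials in the `tᵢ` over the ring of
functions on `V` (`Trivialization.laurentEval_bijective`). It follows that `P` is integral, and that
the coordinates over two members of the cover differ by the pull-back of the cocycles `gᵢ`
(`isTorusAtlas`). All the rest takes place in the field extension `K(X) → K(P)`.

*Units.* The units of a Laurent polynomial ring over a field are the monomials. Hence an invertible
function on `p⁻¹(V)` is `a · t^m` with `a` an invertible function on `V`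
(`IsTorusChart.exists_eq_mul_monomialHom`).

*Local triviality.* The key point is that a Cartier divisor `D` on `P` is principal on `p⁻¹(V)` for
some neighbourhood `V` of each given point `x` of `X` (`IsTorusChart.exists_localEquation`). On an
affine `p⁻¹(V)` the divisor is an invertible fractional ideal (`IsCartier.exists_sum_mul_eq_one`),
which gives finite families with `∑ vⱼ wⱼ = 1` and all `vⱼ wₖ` Laurent polynomials over the ring of
functions on `V`. The ring of Laurent polynomials over `K(X)` is factorial, so there is a rational
function `d` such that all `vⱼ / d` and `d wⱼ` lie in it (`exists_gcd_of_sum_mul_eq_one`); replace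
`vⱼ` and `wⱼ` by these. Let `A` be the local ring of `X` at `x`. Evaluation at `t = 1` shows, as `A`
is local, that one of the `vⱼ(1) wⱼ(1)` is a unit of `A`, so that a constant factor makes
`vⱼ(1) = 1`. Since `A` is integrally closed, it is the intersection of the valuation rings above it,
and the Gauss lemma over each of them shows that the products of the coefficients of `vⱼ` and `wₖ`
lie in `A` (`coeff_mul_coeff_mem_of_isIntegrallyClosed`); therefore the coefficients of the `vⱼ` and
`wₖ` do so too (`exists_smul_coeff_mem`), and `d`, up to the constant, is a local equation of `D`
near `p⁻¹(x)`.

*Surjectivity.* The local equations of `D` found on the sets `p⁻¹(V)` differ, by the description of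
units over `V ∩ V'`, by functions on `X` and monomials. Since monomials are invertible on the
bundle, the functions on `X` are the local equations of a Cartier divisor on `X` whose pull-back is
equivalent to `D` (`IsTorusAtlas.exists_isCartier`).

*Kernel.* If the pull-back of a divisor `E` on `X` is principal, its equation is, on each chart, a
function on `X` times a monomial, with an exponent `m` that does not depend on the chart. As the
coordinates of the charts differ by the `gᵢ`, the divisor `E` is a combination of the divisors of
the `gᵢ`, with coefficients given by `m`, up to a principal divisor
(`IsTorusAtlas.exists_isPrincipalDivisor`).
-/

noncomputable section

namespace TorusBundle

universe u

/-! ### Group algebras over a field -/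

section GroupAlgebra

/-- The units of a group algebra over a field are the monomials with nonzero coefficient, if
products of finite subsets of the group have the two unique products property. -/
lemma exists_single_of_mul_eq_one {K M : Type*} [Field K] [AddCommGroup M] [TwoUniqueSums M]
    {q q' : AddMonoidAlgebra K M} (h : q * q' = 1) :
    ∃ (m : M) (a : K), a ≠ 0 ∧ q = .single m a ∧ q' = .single (-m) a⁻¹ := by
  classical
  have hq : q ≠ 0 := by rintro rfl; simp at h
  have hq' : q' ≠ 0 := by rintro rfl; simp at h
  have hc : q.coeff.support.Nonempty := by simpa [Finsupp.support_nonempty_iff] using hq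
  have hc' : q'.coeff.support.Nonempty := by simpa [Finsupp.support_nonempty_iff] using hq'
  have hcard : ¬ 1 < q.coeff.support.card * q'.coeff.support.card := by
    intro hlt
    obtain ⟨p, hp, p', hp', hne, hu, hu'⟩ := TwoUniqueSums.uniqueAdd_of_one_lt_card hlt
    rw [Finset.mem_product] at hp hp'
    have key : ∀ r : M × M, r.1 ∈ q.coeff.support → r.2 ∈ q'.coeff.support →
        UniqueAdd q.coeff.support q'.coeff.support r.1 r.2 → r.1 + r.2 = 0 := by
      intro r h1 h2 hr
      have := AddMonoidAlgebra.coeff_mul_add_of_uniqueAdd hr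
      rw [h, AddMonoidAlgebra.one_def, AddMonoidAlgebra.coeff_single] at this
      by_contra h0
      rw [Finsupp.single_eq_of_ne h0] at this
      exact mul_ne_zero (Finsupp.mem_support_iff.mp h1) (Finsupp.mem_support_iff.mp h2) this.symm
    have e := hu hp'.1 hp'.2 ((key p' hp'.1 hp'.2 hu').trans (key p hp.1 hp.2 hu).symm)
    exact hne (Prod.ext e.1.symm e.2.symm)
  have h1 : q.coeff.support.card = 1 := by
    have := hc.card_pos; have := hc'.card_pos; nlinarith
  obtain ⟨m, hm⟩ := Finset.card_eq_one.mp h1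
  obtain ⟨a, ha, hqa⟩ : ∃ a, a ≠ 0 ∧ q = .single m a := by
    obtain ⟨ha, hq⟩ := Finsupp.support_eq_singleton.mp hm
    exact ⟨_, ha, AddMonoidAlgebra.ext (by simpa using hq)⟩
  refine ⟨m, a, ha, hqa, ?_⟩
  have hinv : AddMonoidAlgebra.single (-m) a⁻¹ * q = 1 := by
    rw [hqa, AddMonoidAlgebra.single_mul_single, AddMonoidAlgebra.one_def]
    simp [ha]
  calc q' = (AddMonoidAlgebra.single (-m) a⁻¹ * q) * q' := by rw [hinv, one_mul]
    _ = _ := by rw [mul_assoc, h, mul_one]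

/-- The Gauss lemma for group algebras over a valuation ring. -/
lemma coeff_mul_coeff_mem_valuationSubring {K M : Type*} [Field K] [AddCommGroup M]
    [TwoUniqueSums M] (V : ValuationSubring K) {q q' : AddMonoidAlgebra K M}
    (h : ∀ m, (q * q').coeff m ∈ V) (m m' : M) : q.coeff m * q'.coeff m' ∈ V := by
  classical
  -- Divide a nonzero element by a coefficient of maximal valuation.
  have prim : ∀ q : AddMonoidAlgebra K M, q ≠ 0 → ∃ (a : K) (f : AddMonoidAlgebra V M), a ≠ 0 ∧
      q = a • AddMonoidAlgebra.mapRingHom M V.subtype f ∧ ∃ m, f.coeff m = 1 := by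
    intro q hq
    have hc : q.coeff.support.Nonempty := by simpa [Finsupp.support_nonempty_iff] using hq
    obtain ⟨m₀, hm₀, hmax⟩ := q.coeff.support.exists_max_image (fun m => V.valuation (q.coeff m)) hc
    have ha : q.coeff m₀ ≠ 0 := Finsupp.mem_support_iff.mp hm₀
    have hmem : ∀ m, (q.coeff m₀)⁻¹ * q.coeff m ∈ V := by
      intro m
      rw [← V.valuation_le_one_iff, map_mul, map_inv₀]
      by_cases hm : m ∈ q.coeff.support
      · exact inv_mul_le_one_of_le₀ (hmax m hm) zero_le
      · simp [Finsupp.notMem_support_iff.mp hm]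
    refine ⟨q.coeff m₀, .ofCoeff (Finsupp.onFinset q.coeff.support
      (fun m => ⟨(q.coeff m₀)⁻¹ * q.coeff m, hmem m⟩) ?_), ha, ?_, m₀, ?_⟩
    · intro m hm
      rw [Finsupp.mem_support_iff]
      intro h0
      exact hm (Subtype.ext (by simp [h0]))
    · ext m
      simp [ha]
    · exact Subtype.ext (by simp [ha])
  rcases eq_or_ne q 0 with rfl | hq
  · simp
  rcases eq_or_ne q' 0 with rfl | hq'
  · simp
  obtain ⟨a, f, ha, rfl, m₀, hf⟩ := prim q hq
  obtain ⟨b, g, hb, rfl, m₁, hg⟩ := prim q' hq'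
  -- The product of the primitive parts is nonzero over the residue field.
  let π := AddMonoidAlgebra.mapRingHom M (IsLocalRing.residue V)
  have hne : ∀ f : AddMonoidAlgebra V M, (∃ m, f.coeff m = 1) → π f ≠ 0 := by
    rintro f ⟨m, hm⟩ h0
    have := congrArg (fun x => x.coeff m) h0
    simp [π, hm] at this
  have hfg : π (f * g) ≠ 0 := by
    rw [map_mul]
    exact mul_ne_zero (hne f ⟨_, hf⟩) (hne g ⟨_, hg⟩)
  obtain ⟨m₂, hm₂⟩ : ∃ m, (π (f * g)).coeff m ≠ 0 := by
    by_contra! hall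
    exact hfg (AddMonoidAlgebra.ext (Finsupp.ext hall))
  have hu : IsUnit ((f * g).coeff m₂) := by
    rw [AddMonoidAlgebra.coeff_mapRingHom] at hm₂
    by_contra hn
    exact hm₂ ((IsLocalRing.residue_eq_zero_iff _).mpr hn)
  have hab : a * b ∈ V := by
    have h2 := h m₂
    rw [smul_mul_smul_comm, ← map_mul, AddMonoidAlgebra.coeff_smul_apply, smul_eq_mul,
      AddMonoidAlgebra.coeff_mapRingHom] at h2
    obtain ⟨u, hu⟩ := hu
    have := V.mul_mem _ _ h2 (↑(u⁻¹) : V).2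
    rw [← hu, mul_assoc] at this
    have e : (V.subtype (u : V)) * ((↑(u⁻¹) : V) : K) = 1 := by
      have := congrArg V.subtype u.mul_inv
      rwa [map_mul, map_one] at this
    rwa [e, mul_one] at this
  have : (a • AddMonoidAlgebra.mapRingHom M V.subtype f).coeff m *
      (b • AddMonoidAlgebra.mapRingHom M V.subtype g).coeff m' =
      (a * b) * ((f.coeff m : K) * (g.coeff m' : K)) := by
    simp; ring
  rw [this]
  exact V.mul_mem _ _ hab (V.mul_mem _ _ (f.coeff m).2 (g.coeff m').2)

/-- Kronecker's theorem on the coefficients of a product, over an integrally closed ring: such a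
ring is an intersection of valuation rings, and these satisfy the Gauss lemma. -/
lemma coeff_mul_coeff_mem_of_isIntegrallyClosed {A K M : Type*} [CommRing A] [IsDomain A]
    [IsIntegrallyClosed A] [Field K] [Algebra A K] [IsFractionRing A K] [AddCommGroup M]
    [TwoUniqueSums M] {q q' : AddMonoidAlgebra K M}
    (h : ∀ m, (q * q').coeff m ∈ (algebraMap A K).range) (m m' : M) :
    q.coeff m * q'.coeff m' ∈ (algebraMap A K).range := by
  have : IsIntegrallyClosedIn (algebraMap A K).range K := by
    rw [Subring.isIntegrallyClosedIn_iff]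
    intro x hx
    have hx' : IsIntegral A x := by
      obtain ⟨p, hp, hpx⟩ := hx
      obtain ⟨p', hp', -, hm⟩ := Polynomial.lifts_and_degree_eq_and_monic
        (f := (algebraMap A K).rangeRestrict) (p := p) (by
          rw [Polynomial.lifts_iff_coeff_lifts]
          exact fun n => (algebraMap A K).rangeRestrict_surjective _) hp
      refine ⟨p', hm, ?_⟩
      rw [← hp', Polynomial.eval₂_map] at hpx
      exact hpx
    obtain ⟨y, rfl⟩ := IsIntegrallyClosed.isIntegral_iff.mp hx'
    exact ⟨y, rfl⟩
  rw [Subring.eq_iInf_of_isIntegrallyClosedIn (R := (algebraMap A K).range), Subring.mem_iInf]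
  rintro ⟨V, hV⟩
  exact coeff_mul_coeff_mem_valuationSubring V (fun m => hV (h m)) m m'

/-- The core of `Pic A[M] = 0` for a normal local domain `A`: families `q, q'` over `K[M]` whose
products `qᵢ q'ⱼ` lie in `A[M]` and with `∑ qᵢ q'ᵢ = 1` have coefficients in `A`, after rescaling
by a constant. Indeed, some product `ε(qᵢ) ε(q'ᵢ)` of augmentations is a unit of `A`. -/
lemma exists_smul_coeff_mem {A K M I : Type*} [CommRing A] [IsDomain A] [IsLocalRing A]
    [IsIntegrallyClosed A] [Field K] [Algebra A K] [IsFractionRing A K] [AddCommGroup M]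
    [TwoUniqueSums M] (s : Finset I) (q q' : I → AddMonoidAlgebra K M)
    (h : ∀ i ∈ s, ∀ j ∈ s, ∀ m, (q i * q' j).coeff m ∈ (algebraMap A K).range)
    (h1 : ∑ i ∈ s, q i * q' i = 1) :
    ∃ c : K, c ≠ 0 ∧ ∀ i ∈ s, ∀ m, (c • q i).coeff m ∈ (algebraMap A K).range ∧
      (c⁻¹ • q' i).coeff m ∈ (algebraMap A K).range := by
  classical
  set S := (algebraMap A K).range
  let ε : AddMonoidAlgebra K M →+* K := AddMonoidAlgebra.liftNCRingHom (RingHom.id K) 1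
    (fun x y => Commute.all _ _)
  have hε : ∀ q, ε q = ∑ m ∈ q.coeff.support, q.coeff m := by
    intro q
    conv_lhs => rw [← AddMonoidAlgebra.sum_coeff_single q]
    simp [ε, Finsupp.sum, map_sum]
  have hεS : ∀ q : AddMonoidAlgebra K M, (∀ m, q.coeff m ∈ S) → ε q ∈ S := fun q hq => by
    rw [hε]; exact sum_mem fun m _ => hq m
  have hprod : ∀ i ∈ s, ∀ j ∈ s, ∀ m m', (q i).coeff m * (q' j).coeff m' ∈ S := fun i hi j hj =>
    coeff_mul_coeff_mem_of_isIntegrallyClosed (h i hi j hj)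
  have hmem : ∀ i ∈ s, ∃ a : A, algebraMap A K a = ε (q i) * ε (q' i) := fun i hi => by
    obtain ⟨a, ha⟩ := hεS _ (h i hi i hi)
    exact ⟨a, by rw [ha, map_mul]⟩
  choose! a ha using hmem
  have hsum : ∑ i ∈ s, a i = 1 := by
    apply IsFractionRing.injective A K
    rw [map_sum, Finset.sum_congr rfl ha, map_one, ← map_one ε, ← h1, map_sum]
    simp
  obtain ⟨i, hi, hu⟩ : ∃ i ∈ s, IsUnit (a i) := by
    by_contra! hall
    have : ∑ i ∈ s, a i ∈ IsLocalRing.maximalIdeal A := sum_mem fun i hi => hall i hi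
    rw [hsum] at this
    exact (IsLocalRing.maximalIdeal.isMaximal A).ne_top ((Ideal.eq_top_iff_one _).mpr this)
  obtain ⟨u, hu⟩ := hu
  have hne : ε (q i) * ε (q' i) ≠ 0 := by
    rw [← ha i hi, ← hu]
    exact (u.isUnit.map (algebraMap A K)).ne_zero
  have hinv : (ε (q i) * ε (q' i))⁻¹ ∈ S := ⟨(↑u⁻¹ : A), by
    rw [← ha i hi, ← hu, eq_comm, inv_eq_iff_eq_inv, eq_comm]
    exact inv_eq_of_mul_eq_one_left (by rw [← map_mul, Units.mul_inv, map_one])⟩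
  refine ⟨(ε (q i))⁻¹, inv_ne_zero (left_ne_zero_of_mul hne), fun j hj m => ⟨?_, ?_⟩⟩
  · have h2 : (q j).coeff m * ε (q' i) ∈ S := by
      rw [hε, Finset.mul_sum]
      exact sum_mem fun m' _ => hprod j hj i hi m m'
    have := mul_mem h2 hinv
    convert this using 1
    simp only [AddMonoidAlgebra.coeff_smul_apply, smul_eq_mul]
    field_simp [left_ne_zero_of_mul hne, right_ne_zero_of_mul hne]
  · have h2 : ε (q i) * (q' j).coeff m ∈ S := by
      rw [hε, Finset.sum_mul]
      exact sum_mem fun m' _ => hprod i hi j hj m' m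
    simpa [AddMonoidAlgebra.coeff_smul_apply] using h2

end GroupAlgebra

/-! ### Factoriality of Laurent polynomial rings over a field -/

section Factorial

/-- Over a factorial ring `R` with fraction field `F`, an invertible fractional ideal generated by
finitely many `vᵢ`, with inverse generated by the `wᵢ`, is principal, generated by a greatest
common divisor. -/
lemma exists_gcd_of_sum_mul_eq_one {R F I : Type*} [CommRing R] [IsDomain R]
    [UniqueFactorizationMonoid R] [Field F] [Algebra R F] [IsFractionRing R F] (s : Finset I)
    (v w : I → F) (h : ∀ i ∈ s, ∀ j ∈ s, v i * w j ∈ (algebraMap R F).range)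
    (h1 : ∑ i ∈ s, v i * w i = 1) :
    ∃ d : F, d ≠ 0 ∧ ∀ i ∈ s, v i * d⁻¹ ∈ (algebraMap R F).range ∧
      w i * d ∈ (algebraMap R F).range := by
  classical
  let _ : NormalizedGCDMonoid R := Classical.choice inferInstance
  obtain ⟨b, hb⟩ := IsLocalization.exist_integer_multiples (nonZeroDivisors R) s v
  have hb0 : algebraMap R F b ≠ 0 := by simp [nonZeroDivisors.ne_zero b.2]
  have hex : ∀ i ∈ s, ∃ a : R, algebraMap R F a = algebraMap R F b * v i := fun i hi => by
    obtain ⟨a, ha⟩ := hb i hi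
    exact ⟨a, by rw [ha, Algebra.smul_def]⟩
  choose! a ha using hex
  have hg0 : s.gcd a ≠ 0 := by
    intro h0
    rw [Finset.gcd_eq_zero_iff] at h0
    have : ∑ i ∈ s, v i * w i = 0 := Finset.sum_eq_zero fun i hi => by
      have := ha i hi
      rw [h0 i hi, map_zero, eq_comm, mul_eq_zero] at this
      rw [this.resolve_left hb0, zero_mul]
    exact zero_ne_one (this.symm.trans h1)
  have hg0' : algebraMap R F (s.gcd a) ≠ 0 := by simpa using hg0
  refine ⟨algebraMap R F (s.gcd a) / algebraMap R F b, div_ne_zero hg0' hb0, fun i hi => ⟨?_, ?_⟩⟩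
  · obtain ⟨c, hc⟩ := Finset.gcd_dvd (f := a) hi
    refine ⟨c, ?_⟩
    have := ha i hi
    rw [hc, map_mul] at this
    field_simp
    linear_combination this
  · obtain ⟨⟨x, y⟩, hxy⟩ := IsLocalization.surj (nonZeroDivisors R) (w i)
    have hy0 : algebraMap R F y ≠ 0 := by simp [nonZeroDivisors.ne_zero y.2]
    dsimp only at hxy
    have hdvd : (b * y : R) ∣ s.gcd a * x := by
      have : (b * y : R) ∣ s.gcd (fun j => a j * x) := by
        apply Finset.dvd_gcd
        intro j hj
        obtain ⟨c, hc⟩ := h j hj i hi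
        refine ⟨c, IsFractionRing.injective R F ?_⟩
        rw [map_mul, ha j hj, map_mul, map_mul, hc, ← hxy]
        ring
      exact this.trans (Finset.gcd_mul_right' s a x).dvd
    obtain ⟨c, hc⟩ := hdvd
    refine ⟨c, ?_⟩
    have := congrArg (algebraMap R F) hc
    simp only [map_mul] at this
    rw [mul_div_assoc', eq_div_iff hb0]
    apply mul_left_cancel₀ hy0
    linear_combination -this - algebraMap R F (s.gcd a) * hxy

instance (K : Type*) [Field K] (n : ℕ) :
    UniqueFactorizationMonoid (AddMonoidAlgebra K (Fin n → ℤ)) := by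
  classical
  -- Laurent polynomials are the localization of polynomials at the monomials.
  let φ : (Fin n →₀ ℕ) →+ (Fin n → ℤ) :=
    { toFun := fun m i => (m i : ℤ)
      map_zero' := by ext; simp
      map_add' := fun a b => by ext; simp }
  have hφ : Function.Injective φ := fun a b hab => by
    ext i
    have := congrFun hab i
    simpa [φ] using this
  let f : MvPolynomial (Fin n) K →+* AddMonoidAlgebra K (Fin n → ℤ) :=
    AddMonoidAlgebra.mapDomainRingHom K φ
  have hf : Function.Injective f := AddMonoidAlgebra.mapDomain_injective hφ
  let _ : Algebra (MvPolynomial (Fin n) K) (AddMonoidAlgebra K (Fin n → ℤ)) := f.toAlgebra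
  let S : Submonoid (MvPolynomial (Fin n) K) :=
    MonoidHom.mrange (MvPolynomial.monomialOneHom K (Fin n))
  have hfm : ∀ m : Fin n →₀ ℕ, f (MvPolynomial.monomial m 1) = .single (φ m) 1 := fun m =>
    AddMonoidAlgebra.mapDomain_single
  have : IsLocalization S (AddMonoidAlgebra K (Fin n → ℤ)) := by
    refine ⟨?_, ?_, ?_⟩
    · rintro ⟨_, m, rfl⟩
      refine IsUnit.of_mul_eq_one (AddMonoidAlgebra.single (-(φ m.toAdd)) 1) ?_
      change f (MvPolynomial.monomial m.toAdd 1) * _ = 1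
      rw [hfm, AddMonoidAlgebra.single_mul_single, AddMonoidAlgebra.one_def]
      simp
    · intro q
      induction q using AddMonoidAlgebra.induction_linear with
      | zero => exact ⟨⟨0, 1⟩, by simp⟩
      | add q q' h h' =>
        obtain ⟨⟨x, y⟩, hx⟩ := h
        obtain ⟨⟨x', y'⟩, hx'⟩ := h'
        refine ⟨⟨x * y' + x' * y, y * y'⟩, ?_⟩
        simp only [Submonoid.coe_mul, map_mul, map_add] at hx hx' ⊢
        linear_combination f y' * hx + f y * hx'
      | single m a =>
        let d : Fin n →₀ ℕ := Finsupp.equivFunOnFinite.symm fun i => (-m i).toNat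
        let e : Fin n →₀ ℕ := Finsupp.equivFunOnFinite.symm fun i => (m i).toNat
        refine ⟨⟨MvPolynomial.monomial e a, ⟨_, Multiplicative.ofAdd d, rfl⟩⟩, ?_⟩
        change AddMonoidAlgebra.single m a * f (MvPolynomial.monomial d 1) =
          f (MvPolynomial.monomial e a)
        have : f (MvPolynomial.monomial e a) = .single (φ e) a :=
          AddMonoidAlgebra.mapDomain_single
        rw [hfm, this, AddMonoidAlgebra.single_mul_single, mul_one]
        congr 1
        ext i
        simp only [φ, d, e, Pi.add_apply, AddMonoidHom.coe_mk, ZeroHom.coe_mk,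
          Finsupp.coe_equivFunOnFinite_symm]
        omega
    · intro x y hxy
      exact ⟨1, by rw [hf hxy]⟩
  exact UniqueFactorizationMonoid.of_isLocalization S _

end Factorial

/-! ### Cocycles and their classes -/

section CocycleClass

variable {Y : Scheme.{u}}

lemma H1.mk_resZ1 {𝒰 𝒱 : PtCover Y} (hle : 𝒰 ≤ 𝒱) (g : Z1 𝒰) :
    H1.mk 𝒱 (TorusBundle.resZ1 hle g) = H1.mk 𝒰 g :=
  H1.of_resH1 hle (QuotientGroup.mk' _ g)

lemma H1.exists_mk (a : H1 Y) : ∃ (𝒰 : PtCover Y) (g : Z1 𝒰), H1.mk 𝒰 g = a := by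
  induction a using Quotient.inductionOn with
  | h a =>
    obtain ⟨𝒰, a⟩ := a
    obtain ⟨g, rfl⟩ := QuotientGroup.mk'_surjective _ a
    exact ⟨𝒰, g, rfl⟩

lemma H1.mk_eq_one {𝒰 : PtCover Y} {g : Z1 𝒰} :
    H1.mk 𝒰 g = 1 ↔ ∃ (𝒱 : PtCover Y) (h : 𝒰 ≤ 𝒱) (c : C0 𝒱), d0 𝒱 c = (resZ1 h g).1 := by
  have key : ∀ (𝒱 : PtCover Y) (h : 𝒰 ≤ 𝒱), resH1 𝒰 𝒱 h (QuotientGroup.mk' _ g) = 1 ↔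
      ∃ c : C0 𝒱, d0 𝒱 c = (resZ1 h g).1 := fun 𝒱 h => by
    refine (QuotientGroup.eq_one_iff (resZ1 h g)).trans ?_
    rw [Subgroup.mem_subgroupOf, MonoidHom.mem_range]
  constructor
  · intro h
    have h1 : H1.of 𝒰 (QuotientGroup.mk' _ g) = H1.of 𝒰 1 := h.trans (map_one _).symm
    obtain ⟨𝒱, h1, h2, h3⟩ := Quotient.exact h1
    refine ⟨𝒱, h1, (key 𝒱 h1).mp (h3.trans ?_)⟩
    exact map_one (resH1 𝒰 𝒱 h2)
  · rintro ⟨𝒱, h, hc⟩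
    have := (key 𝒱 h).mpr hc
    rw [← H1.mk_resZ1 h]
    exact (congrArg (H1.of 𝒱) this).trans (map_one _)

end CocycleClass

/-! ### Regular functions on an integral scheme as elements of the function field -/

section FunctionField

variable (Y : Scheme.{u}) [IsIntegral Y]

/-- The subring of rational functions on `Y` that are regular at `y`, that is, the local ring of
`Y` at `y` inside the function field. -/
def regAt (y : Y) : Subring Y.functionField :=
  (algebraMap (Y.presheaf.stalk y) Y.functionField).range

variable {Y}

lemma generic_mem {U : Y.Opens} {y : Y} (hy : y ∈ U) : genericPoint Y ∈ U :=
  ((genericPoint_spec Y).mem_open_set_iff U.isOpen).mpr ⟨y, trivial, hy⟩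

/-- The rational function defined by a section over a nonempty open set. -/
def toFF (U : Y.Opens) (hU : genericPoint Y ∈ U) : Γ(Y, U) →+* Y.functionField :=
  (Y.presheaf.germ U (genericPoint Y) hU).hom

lemma toFF_injective (U : Y.Opens) (hU : genericPoint Y ∈ U) : Function.Injective (toFF U hU) :=
  germ_injective_of_isIntegral Y _ hU

lemma toFF_map {U V : Y.Opens} (hU : genericPoint Y ∈ U) (hV : genericPoint Y ∈ V) (i : V ⟶ U)
    (s : Γ(Y, U)) : toFF V hV (Y.presheaf.map i.op s) = toFF U hU s :=
  Y.presheaf.germ_res_apply i _ hV s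

lemma algebraMap_germ {U : Y.Opens} {y : Y} (hy : y ∈ U) (s : Γ(Y, U)) :
    algebraMap (Y.presheaf.stalk y) Y.functionField (Y.presheaf.germ U y hy s) =
      toFF U (generic_mem hy) s := by
  have : Nonempty U := ⟨⟨y, hy⟩⟩
  exact Scheme.algebraMap_germ_eq_germToFunctionField Y hy s

lemma toFF_mem_regAt {U : Y.Opens} (hU : genericPoint Y ∈ U) {y : Y} (hy : y ∈ U) (s : Γ(Y, U)) :
    toFF U hU s ∈ regAt Y y :=
  ⟨_, algebraMap_germ hy s⟩

lemma exists_toFF_of_mem_regAt {f : Y.functionField} {y : Y} (hf : f ∈ regAt Y y) :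
    ∃ (V : Y.Opens) (hV : genericPoint Y ∈ V) (s : Γ(Y, V)), y ∈ V ∧ toFF V hV s = f := by
  obtain ⟨t, rfl⟩ := hf
  obtain ⟨V, hy, s, rfl⟩ := Y.presheaf.exists_germ_eq t
  exact ⟨V, generic_mem hy, s, hy, (algebraMap_germ hy s).symm⟩

lemma exists_forall_mem_regAt {f : Y.functionField} {y : Y} (hf : f ∈ regAt Y y) :
    ∃ V : Y.Opens, y ∈ V ∧ ∀ z ∈ V, f ∈ regAt Y z := by
  obtain ⟨V, hV, s, hy, rfl⟩ := exists_toFF_of_mem_regAt hf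
  exact ⟨V, hy, fun z hz => toFF_mem_regAt hV hz s⟩

/-- A rational function that is regular at all points of a nonempty open set is a section. -/
lemma exists_toFF_eq {U : Y.Opens} (hU : genericPoint Y ∈ U) {f : Y.functionField}
    (hf : ∀ y ∈ U, f ∈ regAt Y y) : ∃ s : Γ(Y, U), toFF U hU s = f := by
  choose V hV s hy hs using fun y : U => exists_toFF_of_mem_regAt (hf y y.2)
  have hle : U ≤ iSup fun y : U => V y ⊓ U := fun y hyU =>
    TopologicalSpace.Opens.mem_iSup.mpr ⟨⟨y, hyU⟩, hy ⟨y, hyU⟩, hyU⟩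
  obtain ⟨t, ht, -⟩ := Y.sheaf.existsUnique_gluing' (fun y : U => V y ⊓ U) U
    (fun y => homOfLE inf_le_right) hle
    (fun y => Y.presheaf.map (homOfLE inf_le_left).op (s y)) (by
      intro y z
      have hg : genericPoint Y ∈ (V y ⊓ U) ⊓ (V z ⊓ U) := ⟨⟨hV y, hU⟩, ⟨hV z, hU⟩⟩
      apply toFF_injective _ hg
      exact ((toFF_map hg.1 hg _ _).trans (toFF_map (hV y) _ _ _)).trans
        ((hs y).trans ((toFF_map hg.2 hg _ _).trans ((toFF_map (hV z) _ _ _).trans (hs z))).symm))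
  refine ⟨t, ?_⟩
  have hg : genericPoint Y ∈ V ⟨_, hU⟩ ⊓ U := ⟨hV _, hU⟩
  refine (toFF_map hU hg (homOfLE inf_le_right) t).symm.trans ?_
  refine (congrArg (toFF _ hg) (ht ⟨_, hU⟩)).trans ?_
  exact (toFF_map (hV _) hg _ _).trans (hs _)

variable (Y) in
/-- The group of rational functions that are invertible at `y`. -/
def unitsAt (y : Y) : Subgroup (Y.functionField)ˣ where
  carrier := {f | (f : Y.functionField) ∈ regAt Y y ∧ ((f⁻¹ : (Y.functionField)ˣ) :
    Y.functionField) ∈ regAt Y y}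
  mul_mem' ha hb := ⟨by simpa using mul_mem ha.1 hb.1, by
    simpa [mul_comm] using mul_mem ha.2 hb.2⟩
  one_mem' := ⟨by simp, by simp⟩
  inv_mem' ha := ⟨ha.2, by simpa using ha.1⟩

/-- The rational function defined by an invertible section. -/
def unitGerm (U : Y.Opens) (hU : genericPoint Y ∈ U) : Γ(Y, U)ˣ →* (Y.functionField)ˣ :=
  Units.map (toFF U hU)

lemma unitGerm_injective (U : Y.Opens) (hU : genericPoint Y ∈ U) :
    Function.Injective (unitGerm U hU) :=
  Units.map_injective (toFF_injective U hU)

lemma unitGerm_resUnits {U V : Y.Opens} (hU : genericPoint Y ∈ U) (hV : genericPoint Y ∈ V)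
    (h : V ≤ U) (a : Γ(Y, U)ˣ) : unitGerm V hV (resUnits Y h a) = unitGerm U hU a :=
  Units.ext (toFF_map hU hV (homOfLE h) a.1)

lemma unitGerm_mem_unitsAt {U : Y.Opens} (hU : genericPoint Y ∈ U) {y : Y} (hy : y ∈ U)
    (a : Γ(Y, U)ˣ) : unitGerm U hU a ∈ unitsAt Y y :=
  ⟨toFF_mem_regAt hU hy _, by rw [← map_inv]; exact toFF_mem_regAt hU hy _⟩

lemma exists_unitGerm_eq {U : Y.Opens} (hU : genericPoint Y ∈ U) {f : (Y.functionField)ˣ}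
    (hf : ∀ y ∈ U, f ∈ unitsAt Y y) : ∃ a : Γ(Y, U)ˣ, unitGerm U hU a = f := by
  obtain ⟨s, hs⟩ := exists_toFF_eq hU fun y hy => (hf y hy).1
  obtain ⟨t, ht⟩ := exists_toFF_eq hU fun y hy => (hf y hy).2
  have hst : s * t = 1 := toFF_injective U hU (by rw [map_mul, hs, ht, map_one, Units.mul_inv])
  exact ⟨⟨s, t, hst, (mul_comm _ _).trans hst⟩, Units.ext hs⟩

lemma exists_forall_mem_unitsAt {f : (Y.functionField)ˣ} {y : Y} (hf : f ∈ unitsAt Y y) :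
    ∃ V : Y.Opens, y ∈ V ∧ ∀ z ∈ V, f ∈ unitsAt Y z := by
  obtain ⟨V, hV, h1⟩ := exists_forall_mem_regAt hf.1
  obtain ⟨W, hW, h2⟩ := exists_forall_mem_regAt hf.2
  exact ⟨V ⊓ W, ⟨hV, hW⟩, fun z hz => ⟨h1 z hz.1, h2 z hz.2⟩⟩

end FunctionField

/-! ### Cartier divisors and `H¹(Y, 𝔾ₘ)` on an integral scheme -/

section Cartier

variable {Y : Scheme.{u}} [IsIntegral Y]

/-- A family of nonzero rational functions, indexed by the points of `Y`, is the family of local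
equations of a Cartier divisor if each member of the family is a local equation also at all points
of a neighbourhood of its index. -/
def IsCartier (D : Y → (Y.functionField)ˣ) : Prop :=
  ∀ y, ∃ V : Y.Opens, y ∈ V ∧ ∀ z ∈ V, D z / D y ∈ unitsAt Y z

/-- A Cartier divisor is principal if it has the same local equation at all points. -/
def IsPrincipalDivisor (D : Y → (Y.functionField)ˣ) : Prop :=
  ∃ f, ∀ y, f / D y ∈ unitsAt Y y

lemma PtCover.generic_mem (𝒰 : PtCover Y) (x : Y) : genericPoint Y ∈ 𝒰.opens x :=
  TorusBundle.generic_mem (𝒰.mem x)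

lemma PtCover.generic_mem₂ (𝒰 : PtCover Y) (x y : Y) :
    genericPoint Y ∈ 𝒰.opens x ⊓ 𝒰.opens y := ⟨𝒰.generic_mem x, 𝒰.generic_mem y⟩

/-- The cocycle `g` is given by the quotients of the local equations `D`. -/
def Represents {𝒰 : PtCover Y} (g : Z1 𝒰) (D : Y → (Y.functionField)ˣ) : Prop :=
  ∀ x y, unitGerm _ (𝒰.generic_mem₂ x y) (g.1 x y) = D y / D x

lemma cocycle_unitGerm {𝒰 : PtCover Y} (g : Z1 𝒰) (x y z : Y) :
    unitGerm _ (𝒰.generic_mem₂ y z) (g.1 y z) * unitGerm _ (𝒰.generic_mem₂ x y) (g.1 x y) =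
      unitGerm _ (𝒰.generic_mem₂ x z) (g.1 x z) := by
  have hg := congrFun (congrFun (congrFun (MonoidHom.mem_ker.mp g.2) x) y) z
  have h3 : genericPoint Y ∈ 𝒰.opens x ⊓ 𝒰.opens y ⊓ 𝒰.opens z :=
    ⟨𝒰.generic_mem₂ x y, 𝒰.generic_mem z⟩
  have := congrArg (unitGerm _ h3) hg
  simp only [d1, MonoidHom.coe_mk, OneHom.coe_mk, Pi.one_apply, map_one, map_div, map_mul,
    div_eq_one] at this
  rwa [unitGerm_resUnits (𝒰.generic_mem₂ y z), unitGerm_resUnits (𝒰.generic_mem₂ x y),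
    unitGerm_resUnits (𝒰.generic_mem₂ x z)] at this

/-- Every cocycle is represented by a divisor, whose local equations are the members of the cocycle
with a fixed first index. -/
lemma represents_self {𝒰 : PtCover Y} (g : Z1 𝒰) (x₀ : Y) :
    Represents g fun x => unitGerm _ (𝒰.generic_mem₂ x₀ x) (g.1 x₀ x) := fun x y => by
  rw [eq_div_iff_mul_eq']
  exact cocycle_unitGerm g x₀ x y

lemma Represents.isCartier {𝒰 : PtCover Y} {g : Z1 𝒰} {D : Y → (Y.functionField)ˣ}
    (h : Represents g D) : IsCartier D := fun y =>
  ⟨𝒰.opens y, 𝒰.mem y, fun z hz => by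
    rw [← h y z]
    have hz' : z ∈ 𝒰.opens y ⊓ 𝒰.opens z := ⟨hz, 𝒰.mem z⟩
    exact unitGerm_mem_unitsAt _ hz' _⟩

lemma Represents.resZ1 {𝒰 𝒱 : PtCover Y} (hle : 𝒰 ≤ 𝒱) {g : Z1 𝒰} {D : Y → (Y.functionField)ˣ}
    (h : Represents g D) : Represents (resZ1 hle g) D := fun x y =>
  (unitGerm_resUnits (𝒰.generic_mem₂ x y) _ _ _).trans (h x y)

lemma Represents.mk_eq_one_iff {𝒰 : PtCover Y} {g : Z1 𝒰} {D : Y → (Y.functionField)ˣ}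
    (h : Represents g D) : H1.mk 𝒰 g = 1 ↔ IsPrincipalDivisor D := by
  rw [H1.mk_eq_one]
  constructor
  · rintro ⟨𝒱, hle, c, hc⟩
    have hD : ∀ x y, D y / D x = unitGerm _ (𝒱.generic_mem y) (c y) /
        unitGerm _ (𝒱.generic_mem x) (c x) := fun x y => by
      rw [← h.resZ1 hle x y, ← hc]
      simp only [d0, MonoidHom.coe_mk, OneHom.coe_mk, map_div]
      rw [unitGerm_resUnits (𝒱.generic_mem y), unitGerm_resUnits (𝒱.generic_mem x)]
    let x₀ := genericPoint Y
    refine ⟨D x₀ / unitGerm _ (𝒱.generic_mem x₀) (c x₀), fun y => ?_⟩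
    have : D x₀ / unitGerm _ (𝒱.generic_mem x₀) (c x₀) / D y =
        (unitGerm _ (𝒱.generic_mem y) (c y))⁻¹ := by
      have := hD x₀ y
      rw [div_eq_iff_eq_mul] at this
      rw [this]
      simp only [div_eq_mul_inv, mul_inv, inv_inv]
      generalize unitGerm _ (𝒱.generic_mem y) (c y) = A
      generalize unitGerm _ (𝒱.generic_mem x₀) (c x₀) = B
      rw [mul_comm A⁻¹, mul_comm (B * A⁻¹), mul_mul_mul_comm, mul_inv_cancel, one_mul,
        inv_mul_cancel_left]
    rw [this]
    exact inv_mem (unitGerm_mem_unitsAt _ (𝒱.mem y) _)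
  · rintro ⟨f, hf⟩
    have hex : ∀ y, ∃ V : Y.Opens, y ∈ V ∧ ∀ z ∈ V, D y / f ∈ unitsAt Y z := fun y =>
      exists_forall_mem_unitsAt (by simpa using inv_mem (hf y))
    choose V hV hu using hex
    let 𝒱 : PtCover Y := ⟨fun y => 𝒰.opens y ⊓ V y, fun y => ⟨𝒰.mem y, hV y⟩⟩
    have hle : 𝒰 ≤ 𝒱 := fun y => inf_le_left
    have hc := fun y => exists_unitGerm_eq (𝒱.generic_mem y) (f := D y / f)
      fun z hz => hu y z hz.2
    choose c hc using hc
    refine ⟨𝒱, hle, c, ?_⟩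
    funext x y
    apply unitGerm_injective _ (𝒱.generic_mem₂ x y)
    rw [h.resZ1 hle x y]
    simp only [d0, MonoidHom.coe_mk, OneHom.coe_mk, map_div]
    rw [unitGerm_resUnits (𝒱.generic_mem y), unitGerm_resUnits (𝒱.generic_mem x), hc, hc,
      div_div_div_cancel_right]

variable (Y) in
/-- The correspondence between classes in `H¹(Y, 𝔾ₘ)` and families of local equations of Cartier
divisors, as a subgroup of the product. -/
def divisorClass : Subgroup (H1 Y × (Y → (Y.functionField)ˣ)) where
  carrier := {a | ∃ (𝒰 : PtCover Y) (g : Z1 𝒰), H1.mk 𝒰 g = a.1 ∧ Represents g a.2}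
  one_mem' := ⟨⟨fun _ => ⊤, fun _ => trivial⟩, 1, map_one _, fun x y => by
    rw [show (1 : Z1 _).1 x y = 1 from rfl]
    simp only [map_one, Prod.snd_one, Pi.one_apply, div_one]⟩
  mul_mem' := by
    rintro ⟨a, D⟩ ⟨b, E⟩ ⟨𝒰, g, rfl, hg⟩ ⟨𝒱, g', rfl, hg'⟩
    obtain ⟨𝒲, h, h'⟩ := exists_ge_ge 𝒰 𝒱
    refine ⟨𝒲, resZ1 h g * resZ1 h' g', ?_, fun x y => ?_⟩
    · rw [map_mul, H1.mk_resZ1, H1.mk_resZ1]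
      rfl
    · have := congrArg₂ (· * ·) (hg.resZ1 h x y) (hg'.resZ1 h' x y)
      refine ((map_mul _ _ _).trans this).trans ?_
      simp only [Prod.mk_mul_mk, Pi.mul_apply]
      exact (mul_div_mul_comm _ _ _ _).symm
  inv_mem' := by
    rintro ⟨a, D⟩ ⟨𝒰, g, rfl, hg⟩
    refine ⟨𝒰, g⁻¹, map_inv _ _, fun x y => ?_⟩
    refine (map_inv _ _).trans ?_
    rw [hg x y]
    simp only [Prod.inv_mk, Pi.inv_apply, inv_div, div_inv_eq_mul]
    rw [div_eq_mul_inv, mul_comm]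

lemma isCartier_of_mem_divisorClass {a : H1 Y} {D : Y → (Y.functionField)ˣ}
    (h : (a, D) ∈ divisorClass Y) : IsCartier D := by
  obtain ⟨𝒰, g, -, hg⟩ := h
  exact hg.isCartier

lemma eq_one_iff_of_mem_divisorClass {a : H1 Y} {D : Y → (Y.functionField)ˣ}
    (h : (a, D) ∈ divisorClass Y) : a = 1 ↔ IsPrincipalDivisor D := by
  obtain ⟨𝒰, g, rfl, hg⟩ := h
  exact hg.mk_eq_one_iff

lemma exists_divisor (a : H1 Y) : ∃ D, (a, D) ∈ divisorClass Y := by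
  obtain ⟨𝒰, g, rfl⟩ := H1.exists_mk a
  exact ⟨_, 𝒰, g, rfl, represents_self g (genericPoint Y)⟩

lemma IsCartier.exists_class {D : Y → (Y.functionField)ˣ} (h : IsCartier D) :
    ∃ a, (a, D) ∈ divisorClass Y := by
  choose V hV hu using h
  let 𝒰 : PtCover Y := ⟨V, hV⟩
  have hc : ∀ x y, ∃ c, unitGerm _ (𝒰.generic_mem₂ x y) c = D y / D x := fun x y =>
    exists_unitGerm_eq _ fun z hz => by
      have := div_mem (hu x z hz.1) (hu y z hz.2)
      rwa [div_div_div_cancel_left] at this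
  choose c hc using hc
  refine ⟨H1.mk 𝒰 ⟨c, ?_⟩, 𝒰, _, rfl, hc⟩
  rw [MonoidHom.mem_ker]
  funext x y z
  have h3 : genericPoint Y ∈ 𝒰.opens x ⊓ 𝒰.opens y ⊓ 𝒰.opens z :=
    ⟨𝒰.generic_mem₂ x y, 𝒰.generic_mem z⟩
  apply unitGerm_injective _ h3
  simp only [d1, MonoidHom.coe_mk, OneHom.coe_mk, Pi.one_apply, map_one, map_div, map_mul]
  rw [unitGerm_resUnits (𝒰.generic_mem₂ y z), unitGerm_resUnits (𝒰.generic_mem₂ x y),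
    unitGerm_resUnits (𝒰.generic_mem₂ x z), hc, hc, hc, div_mul_div_cancel, div_self']

end Cartier

/-! ### Pull-back of rational functions and of Cartier divisors -/

section Pullback

variable {X Y : Scheme.{u}} [IsIntegral X] [IsIntegral Y] (f : Y ⟶ X)
  (hf : f (genericPoint Y) = genericPoint X)

/-- The homomorphism of function fields induced by a dominant morphism. -/
def pullFF : X.functionField →+* Y.functionField :=
  (X.presheaf.stalkSpecializes (specializes_of_eq hf) ≫ f.stalkMap (genericPoint Y)).hom

lemma pullFF_toFF {U : X.Opens} {V : Y.Opens} (hU : genericPoint X ∈ U) (hV : genericPoint Y ∈ V)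
    (h : V ≤ f ⁻¹ᵁ U) (s : Γ(X, U)) :
    pullFF f hf (toFF U hU s) = toFF V hV (f.appLE U V h s) := by
  have hU' : f (genericPoint Y) ∈ U := h hV
  have h1 := Y.presheaf.germ_res_apply (homOfLE h) _ hV (f.app U s)
  refine Eq.trans ?_ h1.symm
  refine Eq.trans ?_ (f.germ_stalkMap_apply U (genericPoint Y) hU' s)
  change f.stalkMap _ (X.presheaf.stalkSpecializes _ (X.presheaf.germ U _ hU s)) = _
  congr 1
  exact X.presheaf.germ_stalkSpecializes_apply hU (specializes_of_eq hf) s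

lemma pullFF_mem_regAt {a : X.functionField} {y : Y} (ha : a ∈ regAt X (f y)) :
    pullFF f hf a ∈ regAt Y y := by
  obtain ⟨V, hV, s, hy, rfl⟩ := exists_toFF_of_mem_regAt ha
  have hy' : y ∈ f ⁻¹ᵁ V := hy
  rw [pullFF_toFF f hf hV (generic_mem hy') le_rfl]
  exact toFF_mem_regAt _ hy' _

lemma map_pullFF_mem_unitsAt {a : (X.functionField)ˣ} {y : Y} (ha : a ∈ unitsAt X (f y)) :
    Units.map (pullFF f hf : X.functionField →* Y.functionField) a ∈ unitsAt Y y :=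
  ⟨pullFF_mem_regAt f hf ha.1, by rw [← map_inv]; exact pullFF_mem_regAt f hf ha.2⟩

/-- The pull-back of a family of local equations. -/
def pullDiv (D : X → (X.functionField)ˣ) (y : Y) : (Y.functionField)ˣ :=
  Units.map (pullFF f hf : X.functionField →* Y.functionField) (D (f y))

lemma pullback_mem_divisorClass {a : H1 X} {D : X → (X.functionField)ˣ}
    (h : (a, D) ∈ divisorClass X) : (H1.pullback f a, pullDiv f hf D) ∈ divisorClass Y := by
  obtain ⟨𝒰, g, rfl, hg⟩ := h
  refine ⟨𝒰.comap f, pullZ1 f 𝒰 g, rfl, fun x y => ?_⟩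
  refine Eq.trans ?_ ((congrArg (Units.map (pullFF f hf : X.functionField →* Y.functionField))
    (hg (f x) (f y))).trans (map_div _ _ _))
  exact Units.ext (pullFF_toFF f hf _ _ _ _).symm

end Pullback

/-! ### Invertible fractional ideals of Cartier divisors on affine open sets -/

section FractionalIdeal

variable {Y : Scheme.{u}} [IsIntegral Y]

lemma exists_pow_mul_mem_regAt {W : Y.Opens} (hW : IsAffineOpen W) (hgW : genericPoint Y ∈ W)
    (b : Γ(Y, W)) {e : Y.functionField} (he : ∀ z ∈ Y.basicOpen b, e ∈ regAt Y z) :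
    ∃ N : ℕ, ∀ z ∈ W, toFF W hgW b ^ N * e ∈ regAt Y z := by
  by_cases hb : genericPoint Y ∈ Y.basicOpen b
  · obtain ⟨s, rfl⟩ := exists_toFF_eq hb he
    have := hW.isLocalization_basicOpen b
    obtain ⟨⟨a, ⟨_, N, rfl⟩⟩, ha⟩ := IsLocalization.surj (Submonoid.powers b) s
    refine ⟨N, fun z hz => ?_⟩
    have h1 := congrArg (toFF _ hb) ha
    rw [map_mul] at h1
    have h2 : ∀ t : Γ(Y, W), toFF _ hb (algebraMap _ _ t) = toFF W hgW t := fun t =>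
      toFF_map hgW hb _ t
    erw [h2, h2] at h1
    rw [map_pow] at h1
    rw [mul_comm, h1]
    exact toFF_mem_regAt hgW hz a
  · have h0 : b = 0 := by
      have : Y.basicOpen b = ⊥ := by
        ext z
        exact ⟨fun hz => hb (generic_mem hz), fun h => h.elim⟩
      rwa [basicOpen_eq_bot_iff] at this
    refine ⟨1, fun z _ => ?_⟩
    rw [h0, map_zero, pow_one, zero_mul]
    exact zero_mem _

lemma toFF_inv_mem_regAt {W : Y.Opens} (hgW : genericPoint Y ∈ W) {b : Γ(Y, W)} {z : Y}
    (hz : z ∈ Y.basicOpen b) : (toFF W hgW b)⁻¹ ∈ regAt Y z := by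
  have hu : IsUnit (Y.presheaf.germ W z (Y.basicOpen_le b hz) b) :=
    (Y.mem_basicOpen b z _).mp hz
  obtain ⟨u, hu⟩ := hu
  refine ⟨(↑u⁻¹ : Y.presheaf.stalk z), ?_⟩
  rw [← algebraMap_germ (Y.basicOpen_le b hz) b, ← hu]
  exact eq_inv_of_mul_eq_one_left (by rw [← map_mul, Units.inv_mul, map_one])

lemma IsCartier.inv {D : Y → (Y.functionField)ˣ} (h : IsCartier D) : IsCartier D⁻¹ := fun y => by
  obtain ⟨V, hV, hu⟩ := h y
  refine ⟨V, hV, fun z hz => ?_⟩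
  have := inv_mem (hu z hz)
  rwa [inv_div, div_eq_mul_inv, mul_comm, ← div_inv_eq_mul] at this

/-- A local equation on a basic open set, multiplied by a power of the function defining the basic
open set, is a section of the fractional ideal of the divisor. -/
lemma IsCartier.exists_pow_mul_mem_regAt {D : Y → (Y.functionField)ˣ} (h : IsCartier D)
    {W : Y.Opens} (hW : IsAffineOpen W) (hgW : genericPoint Y ∈ W) (b : Γ(Y, W)) (y : Y)
    (hb : ∀ z ∈ Y.basicOpen b, D z / D y ∈ unitsAt Y z) :
    ∃ N : ℕ, ∀ z ∈ W, toFF W hgW b ^ N * ((D y / D z : (Y.functionField)ˣ) : Y.functionField) ∈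
      regAt Y z := by
  classical
  let S : Set Γ(Y, W) := {b | ∃ y, ∀ z ∈ Y.basicOpen b, D z / D y ∈ unitsAt Y z}
  have hS : Ideal.span S = ⊤ := by
    rw [← hW.self_le_iSup_basicOpen_iff]
    intro y hy
    obtain ⟨V, hV, hu⟩ := h y
    obtain ⟨b, hbV, hyb⟩ := hW.exists_basicOpen_le ⟨y, hV⟩ hy
    exact TopologicalSpace.Opens.mem_iSup.mpr ⟨⟨b, y, fun z hz => hu z (hbV hz)⟩, hyb⟩
  obtain ⟨T, hTS, hT⟩ := (Ideal.span_eq_top_iff_finite _).mp hS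
  have hex : ∀ g ∈ T, ∃ N : ℕ, ∀ z ∈ Y.basicOpen g,
      toFF W hgW b ^ N * ((D y / D z : (Y.functionField)ˣ) : Y.functionField) ∈ regAt Y z := by
    intro g hg
    obtain ⟨y', hy'⟩ := hTS hg
    obtain ⟨N, hN⟩ := TorusBundle.exists_pow_mul_mem_regAt hW hgW (b * g)
      (e := ((D y / D y' : (Y.functionField)ˣ) : Y.functionField)) (by
        intro z hz
        rw [Y.basicOpen_mul] at hz
        have := (div_mem (hy' z hz.2) (hb z hz.1)).1
        rwa [div_div_div_cancel_left] at this)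
    refine ⟨N, fun z hz => ?_⟩
    have h1 := mul_mem (mul_mem (hN z (Y.basicOpen_le g hz))
      (pow_mem (toFF_inv_mem_regAt hgW hz) N)) (inv_mem (hy' z hz)).1
    have hg0 : toFF W hgW g ≠ 0 := fun h0 => by
      rw [map_eq_zero_iff _ (toFF_injective W hgW)] at h0
      rw [h0, Scheme.basicOpen_zero] at hz
      exact hz
    convert h1 using 1
    rw [map_mul, mul_pow, inv_div, Units.val_div_eq_div_val, Units.val_div_eq_div_val,
      Units.val_div_eq_div_val, inv_pow]
    have := (D y').ne_zero
    have := (D z).ne_zero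
    field_simp
  choose! N hN using hex
  refine ⟨T.sup N, fun z hz => ?_⟩
  have hcov := (hW.self_le_iSup_basicOpen_iff (s := (T : Set Γ(Y, W)))).mpr hT
  obtain ⟨⟨g, hg⟩, hzg⟩ := TopologicalSpace.Opens.mem_iSup.mp (hcov hz)
  obtain ⟨k, hk⟩ := Nat.exists_eq_add_of_le (Finset.le_sup (f := N) hg)
  rw [hk, add_comm, pow_add, mul_assoc]
  exact mul_mem (pow_mem (toFF_mem_regAt hgW hz b) k) (hN g hg z hzg)

/-- The fractional ideal of a Cartier divisor on an affine open set `W` is invertible: there are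
sections `vᵢ` of the ideal and sections `wᵢ` of its inverse with `∑ vᵢ wᵢ = 1`. -/
lemma IsCartier.exists_sum_mul_eq_one {D : Y → (Y.functionField)ˣ} (h : IsCartier D)
    {W : Y.Opens} (hW : IsAffineOpen W) (hgW : genericPoint Y ∈ W) :
    ∃ (k : ℕ) (v w : Fin k → Y.functionField), ∑ i, v i * w i = 1 ∧
      ∀ i, ∀ z ∈ W, v i * ((D z)⁻¹ : (Y.functionField)ˣ) ∈ regAt Y z ∧
        w i * D z ∈ regAt Y z := by
  let _ : Algebra Γ(Y, W) Y.functionField := (toFF W hgW).toAlgebra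
  -- `I E` is the module of sections over `W` of the line bundle with local generators `E⁻¹`.
  have hsmul : ∀ (b : Γ(Y, W)) (s : Y.functionField), b • s = toFF W hgW b * s := fun _ _ => rfl
  let I : (Y → (Y.functionField)ˣ) → Submodule Γ(Y, W) Y.functionField := fun E =>
    { carrier := {s | ∀ z ∈ W, s * E z ∈ regAt Y z}
      add_mem' := fun {a b} ha hb z hz => by rw [add_mul]; exact add_mem (ha z hz) (hb z hz)
      zero_mem' := fun z _ => by rw [zero_mul]; exact zero_mem _
      smul_mem' := fun b s hs z hz => by
        rw [hsmul, mul_assoc]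
        exact mul_mem (toFF_mem_regAt hgW hz b) (hs z hz) }
  have hone : (1 : Y.functionField) ∈ I D⁻¹ * I D := by
    let 𝔞 : Ideal Γ(Y, W) := (I D⁻¹ * I D).comap (Algebra.linearMap _ _)
    suffices h𝔞 : 𝔞 = ⊤ by
      have : (1 : Γ(Y, W)) ∈ 𝔞 := h𝔞 ▸ trivial
      rw [Submodule.mem_comap] at this
      rwa [Algebra.linearMap_apply, map_one] at this
    -- `𝔞` is the unit ideal because the basic open sets of its elements cover `W`.
    rw [← Ideal.span_eq 𝔞, ← hW.self_le_iSup_basicOpen_iff]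
    intro y hy
    obtain ⟨V, hV, hu⟩ := h y
    obtain ⟨b, hbV, hyb⟩ := hW.exists_basicOpen_le ⟨y, hV⟩ hy
    have hb : ∀ z ∈ Y.basicOpen b, D z / D y ∈ unitsAt Y z := fun z hz => hu z (hbV hz)
    obtain ⟨N, hN⟩ := h.exists_pow_mul_mem_regAt hW hgW b y hb
    obtain ⟨N', hN'⟩ := h.inv.exists_pow_mul_mem_regAt hW hgW b y fun z hz => by
      have := inv_mem (hb z hz)
      rwa [inv_div, div_eq_mul_inv, mul_comm, ← div_inv_eq_mul] at this
    have hmem : b ^ (N + N') ∈ 𝔞 := by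
      rw [Submodule.mem_comap, Algebra.linearMap_apply]
      have e : algebraMap Γ(Y, W) Y.functionField (b ^ (N + N')) =
          (toFF W hgW b ^ N * D y) *
            (toFF W hgW b ^ N' * ((D y)⁻¹ : (Y.functionField)ˣ)) := by
        rw [mul_mul_mul_comm, Units.mul_inv, mul_one, ← pow_add, ← map_pow]
        rfl
      rw [e]
      refine Submodule.mul_mem_mul (fun z hz => ?_) fun z hz => ?_
      · have := hN z hz
        rwa [div_eq_mul_inv, Units.val_mul, ← mul_assoc] at this
      · have := hN' z hz
        rwa [div_eq_mul_inv, Units.val_mul, ← mul_assoc, Pi.inv_apply, Pi.inv_apply,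
          inv_inv] at this
    refine TopologicalSpace.Opens.mem_iSup.mpr ⟨⟨b * b ^ (N + N'), 𝔞.mul_mem_left _ hmem⟩, ?_⟩
    change y ∈ Y.basicOpen (b * b ^ (N + N'))
    rw [← pow_succ', Y.basicOpen_pow _ (Nat.succ_pos _)]
    exact hyb
  rw [Submodule.mul_eq_span_mul_set, Submodule.mem_span_set'] at hone
  obtain ⟨k, f, g, hfg⟩ := hone
  have hex : ∀ i, ∃ a ∈ I D⁻¹, ∃ b ∈ I D, a * b = (g i : Y.functionField) := fun i =>
    Set.mem_mul.mp (g i).2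
  choose a ha b hb hab using hex
  refine ⟨k, fun i => f i • a i, b, ?_, fun i z hz => ⟨(I D⁻¹).smul_mem (f i) (ha i) z hz,
    hb i z hz⟩⟩
  rw [← hfg]
  exact Finset.sum_congr rfl fun i _ => by rw [smul_mul_assoc, hab]

end FractionalIdeal

/-! ### Evaluation of Laurent polynomials -/

section Laurent

variable {R S : Type*} [CommRing R] [CommRing S] {n : ℕ}

/-- The homomorphism `ℤⁿ → Sˣ`, `m ↦ t^m`, given by units `t₁, …, tₙ`. -/
def monomialHom (t : Fin n → Sˣ) : Multiplicative (Fin n → ℤ) →* Sˣ where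
  toFun m := ∏ i, t i ^ m.toAdd i
  map_one' := by simp
  map_mul' a b := by simp [zpow_add, Finset.prod_mul_distrib]

/-- Evaluation of Laurent polynomials at units `t₁, …, tₙ`, with coefficients mapped by `f`. -/
def laurentEval (f : R →+* S) (t : Fin n → Sˣ) : AddMonoidAlgebra R (Fin n → ℤ) →+* S :=
  AddMonoidAlgebra.liftNCRingHom f ((Units.coeHom S).comp (monomialHom t))
    fun _ _ => Commute.all _ _

lemma laurentEval_single (f : R →+* S) (t : Fin n → Sˣ) (m : Fin n → ℤ) (a : R) :
    laurentEval f t (.single m a) = f a * (monomialHom t (.ofAdd m) : Sˣ) :=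
  AddMonoidAlgebra.liftNCRingHom_single _ _ _ _ _

lemma laurentEval_eq_sum (f : R →+* S) (t : Fin n → Sˣ) (q : AddMonoidAlgebra R (Fin n → ℤ)) :
    laurentEval f t q =
      ∑ m ∈ q.coeff.support, f (q.coeff m) * (monomialHom t (.ofAdd m) : Sˣ) := by
  conv_lhs => rw [← AddMonoidAlgebra.sum_coeff_single q]
  simp [Finsupp.sum, map_sum, laurentEval_single]

lemma laurentEval_smul (f : R →+* S) (t : Fin n → Sˣ) (a : R)
    (q : AddMonoidAlgebra R (Fin n → ℤ)) :
    laurentEval f t (a • q) = f a * laurentEval f t q := by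
  have : a • q = AddMonoidAlgebra.single 0 a * q := by
    ext m
    simp
  rw [this, map_mul, laurentEval_single]
  congr 1
  simp

end Laurent

/-! ### Torus bundles over normal bases in terms of function fields -/

section Chart

variable {X P : Scheme.{u}} [IsIntegral X] [IsIntegral P] (p : P ⟶ X)
  (hp : p (genericPoint P) = genericPoint X) {n : ℕ}

/-- The group homomorphism `K(X)ˣ → K(P)ˣ`. -/
abbrev pullUnitsFF : (X.functionField)ˣ →* (P.functionField)ˣ :=
  Units.map (pullFF p hp : X.functionField →* P.functionField)

/-- The rational functions `t₁, …, tₙ` are the coordinates of an isomorphism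
`p⁻¹(U) ≃ 𝔾ₘⁿ × U` over `U`: they are invertible on `p⁻¹(U)`, and for each affine open `V ⊆ U`
the inverse image `p⁻¹(V)` is affine, with ring of functions the Laurent polynomials in
`t₁, …, tₙ` over the ring of functions on `V`. -/
structure IsTorusChart (U : X.Opens) (t : Fin n → (P.functionField)ˣ) : Prop where
  generic_mem : genericPoint X ∈ U
  mem_unitsAt : ∀ y, p y ∈ U → ∀ i, t i ∈ unitsAt P y
  injective : Function.Injective (laurentEval (pullFF p hp) t)
  isAffineOpen : ∀ V : X.Opens, V ≤ U → IsAffineOpen V → IsAffineOpen (p ⁻¹ᵁ V)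
  exists_laurent : ∀ V : X.Opens, V ≤ U → IsAffineOpen V → genericPoint X ∈ V →
    ∀ f : P.functionField, (∀ y, p y ∈ V → f ∈ regAt P y) →
      ∃ q, laurentEval (pullFF p hp) t q = f ∧ ∀ m, ∀ v ∈ V, q.coeff m ∈ regAt X v

variable {p hp} {U : X.Opens} {t : Fin n → (P.functionField)ˣ}

namespace IsTorusChart

variable (h : IsTorusChart p hp U t)
include h

lemma monomialHom_mem_unitsAt {y : P} (hy : p y ∈ U) (m : Multiplicative (Fin n → ℤ)) :
    monomialHom t m ∈ unitsAt P y :=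
  prod_mem fun i _ => zpow_mem (h.mem_unitsAt y hy i) _

lemma laurentEval_mem_regAt {y : P} (hy : p y ∈ U)
    {q : AddMonoidAlgebra X.functionField (Fin n → ℤ)}
    (hq : ∀ m, q.coeff m ∈ regAt X (p y)) : laurentEval (pullFF p hp) t q ∈ regAt P y := by
  rw [laurentEval_eq_sum]
  exact sum_mem fun m _ => mul_mem (pullFF_mem_regAt p hp (hq m))
    (h.monomialHom_mem_unitsAt hy _).1

lemma pullUnitsFF_mul_monomialHom_inj {a a' : (X.functionField)ˣ}
    {m m' : Multiplicative (Fin n → ℤ)} (he : pullUnitsFF p hp a * monomialHom t m =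
      pullUnitsFF p hp a' * monomialHom t m') : a = a' ∧ m = m' := by
  have h1 : laurentEval (pullFF p hp) t (.single m.toAdd a) =
      laurentEval (pullFF p hp) t (.single m'.toAdd a') := by
    rw [laurentEval_single, laurentEval_single]
    exact congrArg Units.val he
  have h2 := AddMonoidAlgebra.single_inj.mp (h.injective h1)
  rcases h2 with ⟨h2, h3⟩ | ⟨h2, -⟩
  · exact ⟨Units.ext h3, h2⟩
  · exact (a.ne_zero h2).elim

/-- An invertible function on `p⁻¹(V)` is an invertible function on `V` times a monomial in the
coordinates. -/
lemma exists_eq_mul_monomialHom {V : X.Opens} (hV : V ≤ U) (hgV : genericPoint X ∈ V)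
    {f : (P.functionField)ˣ} (hf : ∀ y, p y ∈ V → f ∈ unitsAt P y) :
    ∃ (a : (X.functionField)ˣ) (m : Multiplicative (Fin n → ℤ)),
      f = pullUnitsFF p hp a * monomialHom t m ∧ ∀ v ∈ V, a ∈ unitsAt X v := by
  have key : ∀ x ∈ V, ∃ (a : (X.functionField)ˣ) (m : Multiplicative (Fin n → ℤ)),
      f = pullUnitsFF p hp a * monomialHom t m ∧ a ∈ unitsAt X x := by
    intro x hx
    obtain ⟨_, ⟨W, hW, rfl⟩, hxW, hWV⟩ :=
      X.isBasis_affineOpens.exists_subset_of_mem_open hx V.isOpen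
    have hgW : genericPoint X ∈ W := TorusBundle.generic_mem hxW
    obtain ⟨q, hq, hqW⟩ := h.exists_laurent W (le_trans hWV hV) hW hgW f
      fun y hy => (hf y (hWV hy)).1
    obtain ⟨q', hq', hqW'⟩ := h.exists_laurent W (le_trans hWV hV) hW hgW
      ((f⁻¹ : (P.functionField)ˣ) : P.functionField) fun y hy => (hf y (hWV hy)).2
    have h1 : q * q' = 1 := h.injective (by rw [map_mul, hq, hq', map_one, Units.mul_inv])
    obtain ⟨m, a, ha, rfl, rfl⟩ := exists_single_of_mul_eq_one h1
    refine ⟨Units.mk0 a ha, .ofAdd m, Units.ext ?_, ?_, ?_⟩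
    · rw [← hq, laurentEval_single]
      rfl
    · simpa using hqW m x hxW
    · simpa using hqW' (-m) x hxW
  obtain ⟨a, m, hfa, -⟩ := key _ hgV
  refine ⟨a, m, hfa, fun v hv => ?_⟩
  obtain ⟨a', m', hfa', ha'⟩ := key v hv
  rwa [(h.pullUnitsFF_mul_monomialHom_inj (hfa.symm.trans hfa')).1]

lemma mem_unitsAt_of_pullUnitsFF {V : X.Opens} (hV : V ≤ U) {a : (X.functionField)ˣ}
    (ha : ∀ y, p y ∈ V → pullUnitsFF p hp a ∈ unitsAt P y) {v : X} (hv : v ∈ V) :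
    a ∈ unitsAt X v := by
  obtain ⟨a', m, he, ha'⟩ := h.exists_eq_mul_monomialHom hV (TorusBundle.generic_mem hv) ha
  have : pullUnitsFF p hp a * monomialHom t 1 = pullUnitsFF p hp a' * monomialHom t m := by
    rw [map_one, mul_one, he]
  rw [(h.pullUnitsFF_mul_monomialHom_inj this).1]
  exact ha' v hv

/-- Every rational function on `P` is a quotient of Laurent polynomials over the function field
of `X`. -/
lemma isFractionRing :
    @IsFractionRing (AddMonoidAlgebra X.functionField (Fin n → ℤ)) _ P.functionField _
      (laurentEval (pullFF p hp) t).toAlgebra := by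
  let _ := (laurentEval (pullFF p hp) t).toAlgebra
  obtain ⟨_, ⟨W, hW, rfl⟩, hxW, hWU⟩ :=
    X.isBasis_affineOpens.exists_subset_of_mem_open h.generic_mem U.isOpen
  have hgP : genericPoint P ∈ p ⁻¹ᵁ W := by
    change p (genericPoint P) ∈ W
    rwa [hp]
  have : Nonempty (p ⁻¹ᵁ W : P.Opens) := ⟨⟨_, hgP⟩⟩
  have := functionField_isFractionRing_of_isAffineOpen P (p ⁻¹ᵁ W) (h.isAffineOpen W hWU hW)
  have : FaithfulSMul (AddMonoidAlgebra X.functionField (Fin n → ℤ)) P.functionField :=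
    (faithfulSMul_iff_algebraMap_injective _ _).mpr h.injective
  refine IsFractionRing.of_field _ _ fun f => ?_
  obtain ⟨a, b, -, rfl⟩ := IsFractionRing.div_surjective (A := Γ(P, p ⁻¹ᵁ W)) f
  obtain ⟨q, hq, -⟩ := h.exists_laurent W hWU hW hxW (algebraMap _ _ a)
    fun y hy => toFF_mem_regAt hgP hy a
  obtain ⟨q', hq', -⟩ := h.exists_laurent W hWU hW hxW (algebraMap _ _ b)
    fun y hy => toFF_mem_regAt hgP hy b
  exact ⟨q, q', by rw [← hq, ← hq']; rfl⟩

/-- A Cartier divisor on `P` is principal on the inverse image of a neighbourhood of each normal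
point of `X`. -/
lemma exists_localEquation {x : X} (hx : x ∈ U)
    (hnormal : IsIntegrallyClosed (X.presheaf.stalk x)) {D : P → (P.functionField)ˣ}
    (hD : IsCartier D) : ∃ (V : X.Opens) (d : (P.functionField)ˣ), x ∈ V ∧ V ≤ U ∧
      ∀ y, p y ∈ V → d / D y ∈ unitsAt P y := by
  classical
  obtain ⟨_, ⟨W, hW, rfl⟩, hxW, hWU⟩ :=
    X.isBasis_affineOpens.exists_subset_of_mem_open hx U.isOpen
  have hgW : genericPoint X ∈ W := TorusBundle.generic_mem hxW
  have hgP : genericPoint P ∈ p ⁻¹ᵁ W := by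
    change p (genericPoint P) ∈ W
    rwa [hp]
  obtain ⟨k, v, w, hvw, hreg⟩ :=
    hD.exists_sum_mul_eq_one (h.isAffineOpen W hWU hW) hgP
  have hvwreg : ∀ i j, ∀ y, p y ∈ W → v i * w j ∈ regAt P y := fun i j y hy => by
    have := mul_mem (hreg i y hy).1 (hreg j y hy).2
    rwa [mul_mul_mul_comm, Units.inv_mul, mul_one] at this
  have hlaurent : ∀ i j, ∃ q, laurentEval (pullFF p hp) t q = v i * w j ∧
      ∀ m, ∀ v ∈ W, q.coeff m ∈ regAt X v := fun i j =>
    h.exists_laurent W hWU hW hgW _ (hvwreg i j)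
  -- Over the generic point of `X` the divisor is principal, with equation `d`.
  let _ := (laurentEval (pullFF p hp) t).toAlgebra
  have := h.isFractionRing
  obtain ⟨d, hd0, hd⟩ := exists_gcd_of_sum_mul_eq_one
    (R := AddMonoidAlgebra X.functionField (Fin n → ℤ)) Finset.univ v w
    (fun i _ j _ => by
      obtain ⟨q, hq, -⟩ := hlaurent i j
      exact ⟨q, hq⟩) hvw
  choose q hq using fun i => (hd i (Finset.mem_univ i)).1
  choose q' hq' using fun i => (hd i (Finset.mem_univ i)).2
  replace hq : ∀ i, laurentEval (pullFF p hp) t (q i) = v i * d⁻¹ := hq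
  replace hq' : ∀ i, laurentEval (pullFF p hp) t (q' i) = w i * d := hq'
  -- The constant `c` corrects `d` to an equation over the local ring at `x`.
  obtain ⟨c, hc0, hc⟩ := exists_smul_coeff_mem (A := X.presheaf.stalk x) Finset.univ q q'
    (fun i _ j _ m => by
      obtain ⟨r, hr, hrW⟩ := hlaurent i j
      have : q i * q' j = r := h.injective (by
        rw [map_mul, hq, hq', hr]
        field_simp)
      rw [this]
      exact hrW m x hxW)
    (h.injective (by
      rw [map_sum, map_one, ← hvw]
      refine Finset.sum_congr rfl fun i _ => ?_
      rw [map_mul, hq, hq']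
      field_simp))
  -- A Laurent polynomial has finitely many coefficients, so if they are regular at `x` then they
  -- are regular on a common neighbourhood.
  have hev : ∀ r : AddMonoidAlgebra X.functionField (Fin n → ℤ),
      (∀ m, r.coeff m ∈ regAt X x) → ∀ᶠ z in nhds x, ∀ m, r.coeff m ∈ regAt X z := by
    intro r hr
    have : ∀ᶠ z in nhds x, ∀ m ∈ r.coeff.support, r.coeff m ∈ regAt X z := by
      rw [Filter.eventually_all_finset]
      intro m _
      obtain ⟨V, hV, hVm⟩ := exists_forall_mem_regAt (hr m)
      filter_upwards [V.isOpen.mem_nhds hV] with z hz using hVm z hz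
    filter_upwards [this] with z hz m
    by_cases hm : m ∈ r.coeff.support
    · exact hz m hm
    · rw [Finsupp.notMem_support_iff.mp hm]
      exact zero_mem _
  have hevall : ∀ᶠ z in nhds x, z ∈ W ∧ ∀ i, (∀ m, (c • q i).coeff m ∈ regAt X z) ∧
      ∀ m, (c⁻¹ • q' i).coeff m ∈ regAt X z := by
    refine (W.isOpen.eventually_mem hxW).and (Filter.eventually_all.mpr fun i => ?_)
    exact (hev _ fun m => (hc i (Finset.mem_univ i) m).1).and
      (hev _ fun m => (hc i (Finset.mem_univ i) m).2)
  obtain ⟨V, hV, hVo, hxV⟩ := eventually_nhds_iff.mp hevall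
  have hpc0 : pullFF p hp c ≠ 0 := by simpa using hc0
  refine ⟨⟨V, hVo⟩, Units.mk0 (d * (pullFF p hp c)⁻¹) (mul_ne_zero hd0 (inv_ne_zero hpc0)), hxV,
    fun z hz => hWU (hV z hz).1, fun y hy => ?_⟩
  have hyW : p y ∈ W := (hV _ hy).1
  have h1 : ∀ i, w i * (d * (pullFF p hp c)⁻¹) ∈ regAt P y := fun i => by
    have := h.laurentEval_mem_regAt (hWU hyW) ((hV _ hy).2 i).2
    rw [laurentEval_smul, hq', map_inv₀] at this
    convert this using 1
    ring
  have h2 : ∀ i, v i * (d * (pullFF p hp c)⁻¹)⁻¹ ∈ regAt P y := fun i => by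
    have := h.laurentEval_mem_regAt (hWU hyW) ((hV _ hy).2 i).1
    rw [laurentEval_smul, hq] at this
    convert this using 1
    rw [mul_inv, inv_inv]
    ring
  constructor
  · rw [Units.val_div_eq_div_val, Units.val_mk0, ← mul_one (d * _), ← hvw, Finset.mul_sum,
      Finset.sum_div]
    refine sum_mem fun i _ => ?_
    have := mul_mem (hreg i y hyW).1 (h1 i)
    convert this using 1
    rw [Units.val_inv_eq_inv_val]
    ring
  · rw [inv_div, Units.val_div_eq_div_val, Units.val_mk0, ← mul_one (D y : P.functionField),
      ← hvw, Finset.mul_sum, Finset.sum_div]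
    refine sum_mem fun i _ => ?_
    have := mul_mem (hreg i y hyW).2 (h2 i)
    convert this using 1
    ring

end IsTorusChart

end Chart

/-! ### The kernel and the image of the pull-back homomorphism -/

section Main

variable {X P : Scheme.{u}} [IsIntegral X] [IsIntegral P] (p : P ⟶ X)
  (hp : p (genericPoint P) = genericPoint X) {n : ℕ}

/-- An atlas of charts of a torus bundle, whose transition functions are the quotients of the local
equations of divisors `G₁, …, Gₙ`. -/
structure IsTorusAtlas (U : X → X.Opens) (t : X → Fin n → (P.functionField)ˣ)
    (G : Fin n → X → (X.functionField)ˣ) : Prop where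
  mem : ∀ x, x ∈ U x
  chart : ∀ x, IsTorusChart p hp (U x) (t x)
  transition : ∀ x y i, t x i = t y i * pullUnitsFF p hp (G i y / G i x)

namespace IsTorusAtlas

variable {p hp} {U : X → X.Opens} {t : X → Fin n → (P.functionField)ˣ}
  {G : Fin n → X → (X.functionField)ˣ} (h : IsTorusAtlas p hp U t G)
include h

lemma monomialHom_eq (x y : X) (m : Multiplicative (Fin n → ℤ)) :
    monomialHom (t x) m = monomialHom (t y) m *
      pullUnitsFF p hp (∏ i, (G i y / G i x) ^ m.toAdd i) := by
  have : ∀ i, t x i = t y i * pullUnitsFF p hp (G i y / G i x) := h.transition x y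
  change ∏ i, t x i ^ m.toAdd i = (∏ i, t y i ^ m.toAdd i) * _
  rw [map_prod, ← Finset.prod_mul_distrib]
  exact Finset.prod_congr rfl fun i _ => by rw [this, mul_zpow, map_zpow]

/-- The divisors `Gᵢ` become principal on the bundle: the coordinates are local equations. -/
lemma isPrincipalDivisor_pullDiv (i : Fin n) : IsPrincipalDivisor (pullDiv p hp (G i)) := by
  let x₀ := genericPoint X
  refine ⟨t x₀ i * pullUnitsFF p hp (G i x₀), fun y => ?_⟩
  have h1 : t x₀ i * pullUnitsFF p hp (G i x₀) / pullDiv p hp (G i) y = t (p y) i := by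
    rw [h.transition (p y) x₀ i, map_div, mul_div_assoc]
    rfl
  rw [h1]
  exact (h.chart (p y)).mem_unitsAt y (h.mem _) i

/-- If a divisor on `X` becomes principal on the bundle, then it is equivalent to a combination of
the `Gᵢ`: a global equation on the bundle is, in each chart, a function on `X` times a monomial in
the coordinates, and the exponent of this monomial is the same in all charts. -/
lemma exists_isPrincipalDivisor {E : X → (X.functionField)ˣ} (hE : IsCartier E)
    (hpE : IsPrincipalDivisor (pullDiv p hp E)) :
    ∃ m : Fin n → ℤ, IsPrincipalDivisor (E / ∏ i, G i ^ m i) := by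
  obtain ⟨f, hf⟩ := hpE
  have key : ∀ x, ∃ (a : (X.functionField)ˣ) (m : Multiplicative (Fin n → ℤ)),
      f = pullUnitsFF p hp a * monomialHom (t x) m ∧ a / E x ∈ unitsAt X x := by
    intro x
    obtain ⟨V, hxV, hV⟩ := hE x
    obtain ⟨b, m, hb, hbV⟩ := (h.chart x).exists_eq_mul_monomialHom (V := V ⊓ U x)
      inf_le_right ⟨generic_mem hxV, (h.chart x).generic_mem⟩
      (f := f / pullUnitsFF p hp (E x)) (by
        intro y hy
        have := mul_mem (hf y) (map_pullFF_mem_unitsAt p hp (hV _ hy.1))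
        rw [map_div] at this
        rwa [pullDiv, div_mul_div_cancel] at this)
    refine ⟨b * E x, m, ?_, ?_⟩
    · rw [map_mul, mul_right_comm, ← hb, div_mul_cancel]
    · rw [mul_div_cancel_right]
      exact hbV x ⟨hxV, h.mem x⟩
  choose a m hfa ha using key
  let x₀ := genericPoint X
  have hconst : ∀ x, a x = a x₀ * ∏ i, (G i x / G i x₀) ^ (m x₀).toAdd i ∧ m x = m x₀ := by
    intro x
    refine (h.chart x).pullUnitsFF_mul_monomialHom_inj ?_
    rw [← hfa x, hfa x₀, h.monomialHom_eq x₀ x, map_mul]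
    ac_rfl
  refine ⟨(m x₀).toAdd, a x₀ * (∏ i, G i x₀ ^ (m x₀).toAdd i)⁻¹, fun x => ?_⟩
  have h1 := ha x
  rw [(hconst x).1] at h1
  convert h1 using 1
  simp only [Pi.div_apply, Finset.prod_apply, Pi.pow_apply, div_zpow, Finset.prod_div_distrib]
  simp only [div_eq_mul_inv, mul_inv, inv_inv]
  ac_rfl

/-- On a bundle over a normal base, each Cartier divisor is equivalent to the pull-back of a divisor
from the base. -/
lemma exists_isCartier (hnormal : ∀ x : X, IsIntegrallyClosed (X.presheaf.stalk x))
    {D : P → (P.functionField)ˣ} (hD : IsCartier D) :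
    ∃ E : X → (X.functionField)ˣ, IsCartier E ∧ IsPrincipalDivisor (D / pullDiv p hp E) := by
  choose V d hxV hVU hd using fun x => (h.chart x).exists_localEquation (h.mem x) (hnormal x) hD
  have hunit : ∀ x x' y, p y ∈ V x → p y ∈ V x' → d x' / d x ∈ unitsAt P y := by
    intro x x' y hy hy'
    have := div_mem (hd x' y hy') (hd x y hy)
    rwa [div_div_div_cancel_right] at this
  let x₀ := genericPoint X
  -- The local equations on the bundle differ from a fixed one by a function on `X` and a monomial.
  have key : ∀ x, ∃ (a : (X.functionField)ˣ) (m : Multiplicative (Fin n → ℤ)),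
      d x = d x₀ * (pullUnitsFF p hp a * monomialHom (t x) m) := by
    intro x
    obtain ⟨a, m, ha, -⟩ := (h.chart x).exists_eq_mul_monomialHom (V := V x ⊓ V x₀)
      (inf_le_left.trans (hVU x)) ⟨generic_mem (hxV x), hxV x₀⟩
      (f := d x / d x₀) fun y hy => hunit x₀ x y hy.2 hy.1
    exact ⟨a, m, by rw [← ha, mul_div_cancel]⟩
  choose E m hE using key
  refine ⟨E, fun x => ⟨V x ⊓ U x, ⟨hxV x, h.mem x⟩, fun z hz => ?_⟩, d x₀, fun y => ?_⟩
  · refine (h.chart x).mem_unitsAt_of_pullUnitsFF (V := V x ⊓ U x ⊓ V z ⊓ U z)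
      (inf_le_left.trans (inf_le_left.trans inf_le_right)) ?_ ⟨⟨hz, hxV z⟩, h.mem z⟩
    intro y hy
    have h1 := hunit x z y hy.1.1.1 hy.1.2
    have h2 := (h.chart x).monomialHom_mem_unitsAt hy.1.1.2 (m x)
    have h3 := (h.chart z).monomialHom_mem_unitsAt hy.2 (m z)
    have h4 := mul_mem h1 (div_mem h2 h3)
    convert h4 using 1
    rw [hE z, hE x, mul_div_mul_left_eq_div, map_div, div_mul_div_comm, mul_assoc, mul_assoc,
      mul_comm (monomialHom _ _) (monomialHom (t z) _), mul_div_mul_right_eq_div]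
  · have h1 := hd (p y) y (hxV _)
    have h2 := (h.chart (p y)).monomialHom_mem_unitsAt (h.mem (p y)) (m (p y))
    have h3 := div_mem h1 h2
    convert h3 using 1
    rw [hE (p y), Pi.div_apply, eq_div_iff_mul_eq']
    simp only [pullDiv, div_eq_mul_inv, mul_inv, inv_inv]
    ac_rfl

/-- The Picard group of the bundle is the quotient of the Picard group of a normal base by the
subgroup generated by the classes of the bundle. -/
theorem exists_mulEquiv (hnormal : ∀ x : X, IsIntegrallyClosed (X.presheaf.stalk x))
    {c : Fin n → H1 X} (hc : ∀ i, (c i, G i) ∈ divisorClass X) :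
    ∃ e : (H1 X ⧸ Subgroup.closure (Set.range c)) ≃* H1 P,
      ∀ a : H1 X, e (QuotientGroup.mk a) = H1.pullback p a := by
  have hsurj : Function.Surjective (H1.pullback p) := by
    intro b
    obtain ⟨D, hD⟩ := exists_divisor b
    obtain ⟨E, hE, hDE⟩ := h.exists_isCartier hnormal (isCartier_of_mem_divisorClass hD)
    obtain ⟨a, ha⟩ := hE.exists_class
    have := div_mem hD (pullback_mem_divisorClass p hp ha)
    exact ⟨a, (div_eq_one.mp ((eq_one_iff_of_mem_divisorClass this).mpr hDE)).symm⟩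
  have hker : (H1.pullback p).ker = Subgroup.closure (Set.range c) := by
    apply le_antisymm
    · intro a ha
      obtain ⟨E, hE⟩ := exists_divisor a
      have hpE := (eq_one_iff_of_mem_divisorClass (pullback_mem_divisorClass p hp hE)).mp ha
      obtain ⟨m, hm⟩ := h.exists_isPrincipalDivisor (isCartier_of_mem_divisorClass hE) hpE
      have h1 : (a, E) / ∏ i, (c i, G i) ^ m i ∈ divisorClass X :=
        div_mem hE (prod_mem fun i _ => zpow_mem (hc i) _)
      have h2 : (a, E) / ∏ i, (c i, G i) ^ m i =
          (a / ∏ i, c i ^ m i, E / ∏ i, G i ^ m i) := by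
        refine Prod.ext ?_ ?_
        · simp only [Prod.fst_div, Prod.fst_prod, Prod.pow_fst]
        · simp only [Prod.snd_div, Prod.snd_prod, Prod.pow_snd]
      rw [h2] at h1
      rw [div_eq_one.mp ((eq_one_iff_of_mem_divisorClass h1).mpr hm)]
      exact prod_mem fun i _ => zpow_mem (Subgroup.subset_closure (Set.mem_range_self i)) _
    · rw [Subgroup.closure_le]
      rintro _ ⟨i, rfl⟩
      exact (eq_one_iff_of_mem_divisorClass (pullback_mem_divisorClass p hp (hc i))).mpr
        (h.isPrincipalDivisor_pullDiv i)
  exact ⟨(QuotientGroup.quotientMulEquivOfEq hker.symm).trans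
    (QuotientGroup.quotientKerEquivOfSurjective _ hsurj), fun a => rfl⟩

end IsTorusAtlas

end Main

/-! ### Rings of functions on a product with a torus -/

section Ring

/-- The units `tᵢ` of the ring of Laurent polynomials over `R`. -/
def laurentUnit (R : Type*) [CommRing R] (n : ℕ) (i : Fin n) : (AddMonoidAlgebra R (Fin n → ℤ))ˣ :=
  (AddMonoidAlgebra.of R (Fin n → ℤ)).toHomUnits (.ofAdd (Pi.single i 1))

lemma coe_monomialHom_laurentUnit (R : Type*) [CommRing R] (n : ℕ)
    (m : Multiplicative (Fin n → ℤ)) :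
    (monomialHom (laurentUnit R n) m : AddMonoidAlgebra R (Fin n → ℤ)) = .single m.toAdd 1 := by
  have : monomialHom (laurentUnit R n) m = (AddMonoidAlgebra.of R (Fin n → ℤ)).toHomUnits m := by
    change ∏ i, (AddMonoidAlgebra.of R (Fin n → ℤ)).toHomUnits (.ofAdd (Pi.single i 1)) ^
      m.toAdd i = _
    simp_rw [← map_zpow, ← map_prod, ← ofAdd_zsmul, ← ofAdd_sum]
    congr 1
    apply Multiplicative.toAdd.injective
    rw [toAdd_ofAdd]
    ext j
    simp [Finset.sum_apply, Pi.single_apply]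
  rw [this]
  rfl

lemma map_monomialHom {R S : Type*} [CommRing R] [CommRing S] {n : ℕ} (f : R →+* S)
    (t : Fin n → Rˣ) (m : Multiplicative (Fin n → ℤ)) :
    Units.map (f : R →* S) (monomialHom t m) =
      monomialHom (fun i => Units.map (f : R →* S) (t i)) m := by
  change Units.map (f : R →* S) (∏ i, t i ^ m.toAdd i) = ∏ i, _ ^ m.toAdd i
  rw [map_prod]
  exact Finset.prod_congr rfl fun i _ => map_zpow _ _ _

lemma map_laurentEval {R S T : Type*} [CommRing R] [CommRing S] [CommRing T] {n : ℕ}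
    (f : R →+* S) (g : S →+* T) (t : Fin n → Sˣ) (q : AddMonoidAlgebra R (Fin n → ℤ)) :
    g (laurentEval f t q) =
      laurentEval (g.comp f) (fun i => Units.map (g : S →* T) (t i)) q := by
  rw [laurentEval_eq_sum, laurentEval_eq_sum, map_sum]
  refine Finset.sum_congr rfl fun m _ => ?_
  rw [map_mul, ← map_monomialHom]
  rfl

lemma laurentEval_mapRingHom {R S T : Type*} [CommRing R] [CommRing S] [CommRing T] {n : ℕ}
    (f : R →+* S) (g : S →+* T) (t : Fin n → Tˣ) (q : AddMonoidAlgebra R (Fin n → ℤ)) :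
    laurentEval g t (AddMonoidAlgebra.mapRingHom _ f q) = laurentEval (g.comp f) t q := by
  induction q using AddMonoidAlgebra.induction_linear with
  | zero => simp
  | add q q' h h' => rw [map_add, map_add, map_add, h, h']
  | single m a =>
    rw [laurentEval_single]
    have : AddMonoidAlgebra.mapRingHom (Fin n → ℤ) f (.single m a) = .single m (f a) := by
      ext; simp
    rw [this, laurentEval_single]
    rfl

open scoped AlgebraMonoidAlgebra in
/-- The base change of the ring of Laurent polynomials is a ring of Laurent polynomials. -/
lemma laurentEval_bijective_of_isPushout {k : Type u} [CommRing k] {R S : CommRingCat.{u}} {n : ℕ}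
    {r : CommRingCat.of k ⟶ R} {f : CommRingCat.of (AddMonoidAlgebra k (Fin n → ℤ)) ⟶ S} {g : R ⟶ S}
    (h : IsPushout (CommRingCat.ofHom (algebraMap k (AddMonoidAlgebra k (Fin n → ℤ)))) r f g) :
    Function.Bijective (laurentEval g.hom fun i =>
      Units.map (f.hom : AddMonoidAlgebra k (Fin n → ℤ) →* S) (laurentUnit k n i)) := by
  let _ : Algebra k R := r.hom.toAlgebra
  have h' := CommRingCat.isPushout_of_isPushout k (AddMonoidAlgebra k (Fin n → ℤ)) R
    (AddMonoidAlgebra R (Fin n → ℤ))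
  let e := h'.isoIsPushout _ _ h
  have he1 : CommRingCat.ofHom (algebraMap (AddMonoidAlgebra k (Fin n → ℤ))
      (AddMonoidAlgebra R (Fin n → ℤ))) ≫ e.hom = f := h'.inl_isoIsPushout_hom _ _ h
  have he2 : CommRingCat.ofHom (algebraMap R (AddMonoidAlgebra R (Fin n → ℤ))) ≫ e.hom = g :=
    h'.inr_isoIsPushout_hom _ _ h
  have hEq : laurentEval g.hom (fun i =>
      Units.map (f.hom : AddMonoidAlgebra k (Fin n → ℤ) →* S) (laurentUnit k n i)) = e.hom.hom := by
    refine RingHom.ext fun q => ?_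
    rw [laurentEval_eq_sum]
    conv_rhs => rw [← AddMonoidAlgebra.sum_coeff_single q]
    rw [Finsupp.sum, map_sum]
    refine Finset.sum_congr rfl fun m _ => ?_
    have e1 : (.single m (q.coeff m) : AddMonoidAlgebra R (Fin n → ℤ)) =
        algebraMap R (AddMonoidAlgebra R (Fin n → ℤ)) (q.coeff m) *
          algebraMap (AddMonoidAlgebra k (Fin n → ℤ)) (AddMonoidAlgebra R (Fin n → ℤ))
            (.single m 1) := by
      have : algebraMap (AddMonoidAlgebra k (Fin n → ℤ)) (AddMonoidAlgebra R (Fin n → ℤ))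
          (.single m 1) = .single m 1 := by
        rw [AddMonoidAlgebra.algebraMap_def]
        ext
        simp
      rw [this, AddMonoidAlgebra.coe_algebraMap]
      simp [AddMonoidAlgebra.single_mul_single]
    rw [e1, map_mul]
    congr 1
    · rw [← he2]
      rfl
    · rw [← map_monomialHom, ← he1]
      rw [Units.coe_map, MonoidHom.coe_coe, coe_monomialHom_laurentUnit]
      rfl
  rw [hEq]
  exact ConcreteCategory.bijective_of_isIso e.hom

end Ring

/-! ### Functions on the inverse image of a trivializing open set -/

section Geometry

lemma isPullback_whiskerLeft_snd {C : Type*} [Category C] [CartesianMonoidalCategory C] (A : C)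
    {Y Z : C} (f : Y ⟶ Z) : IsPullback (A ◁ f) (snd A Y) (snd A Z) f where
  w := by simp
  isLimit' := ⟨Limits.PullbackCone.IsLimit.mk _
    (fun s => lift (s.fst ≫ fst A Z) s.snd)
    (fun s => by
      ext
      · simp
      · simp [s.condition])
    (fun s => by simp)
    (fun s m h1 h2 => by
      ext
      · simp [← h1]
      · simp [← h2])⟩

lemma isPullback_restrict {n : ℕ} {X P : SchC} {p : P ⟶ X} {U V : X.left.Opens}
    {φ : Torus n ⊗ opn X U ⟶ P} (hφ : IsPullback φ (snd (Torus n) (opn X U)) p (opnι X U))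
    (h : V ≤ U) : IsPullback ((Torus n ◁ opnIncl X h) ≫ φ) (snd (Torus n) (opn X V)) p
      (opnι X V) := by
  have h1 : opnIncl X h ≫ opnι X U = opnι X V := by
    ext : 1
    exact X.left.homOfLE_ι h
  rw [← h1]
  exact (isPullback_whiskerLeft_snd (Torus n) (opnIncl X h)).flip.paste_vert hφ.flip |>.flip

lemma isPullback_left {S : Scheme.{u}} {A B C D : Over S} {f : A ⟶ B} {g : A ⟶ C} {h : B ⟶ D}
    {i : C ⟶ D} (H : IsPullback f g h i) : IsPullback f.left g.left h.left i.left :=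
  H.map (Over.forget S)

lemma isOpenImmersion_of_isPullback {X P Z : Scheme.{u}} {p : P ⟶ X} {V : X.Opens} {j : Z ⟶ P}
    {s : Z ⟶ V} (h : IsPullback j s p V.ι) : IsOpenImmersion j :=
  MorphismProperty.of_isPullback h.flip inferInstance

lemma opensRange_of_isPullback {X P Z : Scheme.{u}} {p : P ⟶ X} {V : X.Opens} {j : Z ⟶ P}
    {s : Z ⟶ V} (h : IsPullback j s p V.ι) [IsOpenImmersion j] : j.opensRange = p ⁻¹ᵁ V := by
  ext x
  change x ∈ Set.range j ↔ p x ∈ V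
  rw [← h.isoPullback_hom_fst, Scheme.Hom.comp_base, TopCat.coe_comp, Set.range_comp,
    Set.range_eq_univ.mpr h.isoPullback.hom.surjective, Set.image_univ]
  erw [IsOpenImmersion.range_pullbackFst]
  simp

lemma isIso_appLE_of_isOpenImmersion {P Z : Scheme.{u}} (j : Z ⟶ P) [IsOpenImmersion j]
    {W : P.Opens} (hW : j.opensRange = W) (h : ⊤ ≤ j ⁻¹ᵁ W) : IsIso (j.appLE W ⊤ h) := by
  have := j.isIso_app W hW.ge
  have h2 : j ⁻¹ᵁ W = ⊤ := top_le_iff.mp h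
  have h3 : IsIso (Z.presheaf.map (homOfLE h).op) := by
    have : homOfLE h = eqToHom h2.symm := rfl
    rw [this]
    infer_instance
  exact IsIso.comp_isIso

lemma comul_coord (n : ℕ) (i : Fin n) :
    (μ[Torus n]).left.appTop (Torus.coord n i) =
      (fst (Torus n) (Torus n)).left.appTop (Torus.coord n i) *
        (snd (Torus n) (Torus n)).left.appTop (Torus.coord n i) := by
  let e := pullbackSpecIso ℂ (Laurent n) (Laurent n)
  have key : ∀ (f : Laurent n →+* TensorProduct ℂ (Laurent n) (Laurent n)),
      (e.hom ≫ Spec.map (CommRingCat.ofHom f)).appTop (Torus.coord n i) =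
        e.hom.appTop ((Scheme.ΓSpecIso _).inv (f (.single (Pi.single i 1) 1))) := by
    intro f
    rw [Scheme.Hom.comp_appTop]
    have := congr($(Scheme.ΓSpecIso_inv_naturality (CommRingCat.ofHom f))
      (.single (Pi.single i 1) 1))
    exact congrArg e.hom.appTop this.symm
  have h1 : (μ[Torus n]).left = e.hom ≫
      Spec.map (CommRingCat.ofHom (Bialgebra.comulAlgHom ℂ (Laurent n)).toRingHom) :=
    mul_spec_asOver_spec_left
  have h2 : (fst (Torus n) (Torus n)).left = e.hom ≫
      Spec.map (CommRingCat.ofHom Algebra.TensorProduct.includeLeftRingHom) :=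
    (pullbackSpecIso_hom_fst _ _ _).symm
  have h3 : (snd (Torus n) (Torus n)).left = e.hom ≫
      Spec.map (CommRingCat.ofHom Algebra.TensorProduct.includeRight.toRingHom) :=
    (pullbackSpecIso_hom_snd _ _ _).symm
  rw [h1, h2, h3]
  refine (key _).trans (Eq.trans ?_ (congrArg₂ (· * ·) (key _) (key _)).symm)
  rw [← map_mul, ← map_mul]
  congr 2
  change Coalgebra.comul (R := ℂ) (A := Laurent n) _ = _
  rw [AddMonoidAlgebra.comul_single]
  simp

/-- The square expressing `𝕋ⁿ × V` as a product. -/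
lemma isPullback_torus (n : ℕ) (Y : SchC) :
    IsPullback (fst (Torus n) Y).left (snd (Torus n) Y).left (Torus n).hom Y.hom :=
  IsPullback.of_hasPullback _ _

lemma isAffine_torus_tensor (n : ℕ) (Y : SchC) [IsAffine Y.left] : IsAffine (Torus n ⊗ Y).left := by
  have : IsAffine (Torus n).left := inferInstanceAs (IsAffine (Spec _))
  have : IsAffineHom Y.hom := inferInstance
  exact IsAffine.of_isPullback (isPullback_torus n Y)

lemma isPushout_torus (n : ℕ) (Y : SchC) [IsAffine Y.left] :
    IsPushout (CommRingCat.ofHom (algebraMap ℂ (Laurent n)))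
      ((Scheme.ΓSpecIso (.of ℂ)).inv ≫ Y.hom.appTop)
      ((Scheme.ΓSpecIso (.of (Laurent n))).inv ≫ (fst (Torus n) Y).left.appTop)
      (snd (Torus n) Y).left.appTop := by
  have : IsAffine (Torus n).left := inferInstanceAs (IsAffine (Spec _))
  have : IsAffine ((Functor.fromPUnit (Spec (.of ℂ))).obj Y.right) :=
    inferInstanceAs (IsAffine (Spec _))
  have h := isPushout_appTop_of_isPullback (isPullback_torus n Y)
  refine h.of_iso (Scheme.ΓSpecIso (.of ℂ)) (Scheme.ΓSpecIso (.of (Laurent n))) (Iso.refl _)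
    (Iso.refl _) ?_ ?_ ?_ ?_
  · exact Scheme.ΓSpecIso_naturality _
  · exact (Category.comp_id _).trans (Iso.hom_inv_id_assoc _ _).symm
  · exact (Category.comp_id _).trans (Iso.hom_inv_id_assoc _ _).symm
  · exact (Category.comp_id _).trans (Category.id_comp _).symm

end Geometry

/-! ### Coordinates of a trivialization -/

section Coordinates

lemma topIso_inv_eq_appLE {X : Scheme.{u}} (V : X.Opens) (h : ⊤ ≤ V.ι ⁻¹ᵁ V) :
    V.topIso.inv = V.ι.appLE V ⊤ h := by
  rw [Scheme.Opens.ι_appLE]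
  rfl

/-- The coordinate `tᵢ` as an invertible function on `𝕋ⁿ × Y`. -/
def torusUnit (n : ℕ) (Y : SchC) (i : Fin n) : Γ((Torus n ⊗ Y).left, ⊤)ˣ :=
  Units.map (((Scheme.ΓSpecIso (.of (Laurent n))).inv ≫ (fst (Torus n) Y).left.appTop).hom :
    Laurent n →* Γ((Torus n ⊗ Y).left, ⊤)) (laurentUnit ℂ n i)

lemma coe_torusUnit (n : ℕ) (Y : SchC) (i : Fin n) :
    (torusUnit n Y i : Γ((Torus n ⊗ Y).left, ⊤)) =
      (fst (Torus n) Y).left.appTop (Torus.coord n i) := rfl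

lemma appTop_appTop {Y Z W : Scheme.{u}} (f : Y ⟶ Z) (g : Z ⟶ W) (s : Γ(W, ⊤)) :
    f.appTop (g.appTop s) = (f ≫ g).appTop s := by
  rw [Scheme.Hom.comp_appTop]
  rfl

variable {n : ℕ} {X P : SchC} {p : P ⟶ X} {U : X.left.Opens}

lemma le_preimage_of_isPullback {V : X.left.Opens} {φ : Torus n ⊗ opn X V ⟶ P}
    (hφ : IsPullback φ (snd (Torus n) (opn X V)) p (opnι X V)) :
    ⊤ ≤ φ.left ⁻¹ᵁ (p.left ⁻¹ᵁ V) := by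
  have := isOpenImmersion_of_isPullback (isPullback_left hφ)
  rw [← opensRange_of_isPullback (isPullback_left hφ)]
  exact fun z _ => ⟨z, rfl⟩

lemma appLE_bijective_of_isPullback {V : X.left.Opens} {φ : Torus n ⊗ opn X V ⟶ P}
    (hφ : IsPullback φ (snd (Torus n) (opn X V)) p (opnι X V)) :
    Function.Bijective (φ.left.appLE (p.left ⁻¹ᵁ V) ⊤ (le_preimage_of_isPullback hφ)) := by
  have := isOpenImmersion_of_isPullback (isPullback_left hφ)
  have := isIso_appLE_of_isOpenImmersion φ.left
    (opensRange_of_isPullback (isPullback_left hφ)) (le_preimage_of_isPullback hφ)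
  exact ConcreteCategory.bijective_of_isIso (φ.left.appLE (p.left ⁻¹ᵁ V) ⊤ _)

lemma app_comp_appLE_of_isPullback {V : X.left.Opens} {φ : Torus n ⊗ opn X V ⟶ P}
    (hφ : IsPullback φ (snd (Torus n) (opn X V)) p (opnι X V)) :
    p.left.app V ≫ φ.left.appLE (p.left ⁻¹ᵁ V) ⊤ (le_preimage_of_isPullback hφ) =
      V.topIso.inv ≫ (snd (Torus n) (opn X V)).left.appTop := by
  have hV : ⊤ ≤ V.ι ⁻¹ᵁ V := fun z _ => z.2
  rw [Scheme.Hom.app_eq_appLE, Scheme.Hom.appLE_comp_appLE, topIso_inv_eq_appLE V hV]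
  have h1 : (snd (Torus n) (opn X V)).left.appTop =
      (snd (Torus n) (opn X V)).left.appLE ⊤ ⊤ le_top :=
    (Scheme.Hom.appLE_eq_app _).symm
  rw [h1]
  refine Eq.trans ?_ (Scheme.Hom.appLE_comp_appLE (snd (Torus n) (opn X V)).left V.ι V ⊤ ⊤
    hV le_top).symm
  have h2 : φ.left ≫ p.left = (snd (Torus n) (opn X V)).left ≫ V.ι := (isPullback_left hφ).w
  congr 1

variable [ModObj (Torus n) P]

lemma Trivialization.le_preimage (φ : Trivialization n p U) :
    ⊤ ≤ φ.hom.left ⁻¹ᵁ (p.left ⁻¹ᵁ U) := by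
  have := isOpenImmersion_of_isPullback (isPullback_left φ.isPullback)
  rw [← opensRange_of_isPullback (isPullback_left φ.isPullback)]
  exact fun z _ => ⟨z, rfl⟩

lemma Trivialization.exists_coordinate (φ : Trivialization n p U) (i : Fin n) :
    ∃ a : Γ(P.left, p.left ⁻¹ᵁ U)ˣ,
      pullUnits φ.hom.left φ.le_preimage a = torusUnit n (opn X U) i := by
  have := isOpenImmersion_of_isPullback (isPullback_left φ.isPullback)
  have := isIso_appLE_of_isOpenImmersion φ.hom.left
    (opensRange_of_isPullback (isPullback_left φ.isPullback)) φ.le_preimage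
  let e := (asIso (φ.hom.left.appLE (p.left ⁻¹ᵁ U) ⊤ φ.le_preimage)).commRingCatIsoToRingEquiv
  refine ⟨Units.map (e.symm : _ →* _) (torusUnit n (opn X U) i), Units.ext ?_⟩
  exact e.apply_symm_apply _

/-- The coordinates on `p⁻¹(U)` given by a trivialization of the bundle over `U`. -/
def Trivialization.coordinate (φ : Trivialization n p U) (i : Fin n) : Γ(P.left, p.left ⁻¹ᵁ U)ˣ :=
  (φ.exists_coordinate i).choose

/-- The coordinates of a trivialization, as functions on a scheme over `𝕋ⁿ × U`. -/
lemma Trivialization.appLE_coordinate (φ : Trivialization n p U) {V : X.left.Opens} (hV : V ≤ U)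
    {A : SchC} (χ : A ⟶ Torus n ⊗ opn X U)
    (h : ⊤ ≤ (χ ≫ φ.hom).left ⁻¹ᵁ (p.left ⁻¹ᵁ V)) (i : Fin n) :
    (χ ≫ φ.hom).left.appLE (p.left ⁻¹ᵁ V) ⊤ h
        (resUnits P.left (p.left.preimage_mono hV) (φ.coordinate i) : _) =
      (χ ≫ fst _ _).left.appTop (Torus.coord n i) := by
  have h1 := congrArg Units.val (φ.exists_coordinate i).choose_spec
  have h2 := congrArg Units.val (pullUnits_resUnits (χ ≫ φ.hom).left
    (p.left.preimage_mono hV) h (φ.coordinate i))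
  refine h2.trans ?_
  have h3 := congr($(Scheme.Hom.appLE_comp_appLE χ.left φ.hom.left (p.left ⁻¹ᵁ U) ⊤ ⊤
    φ.le_preimage le_top) (φ.coordinate i : Γ(P.left, p.left ⁻¹ᵁ U)))
  refine h3.symm.trans ?_
  refine (congrArg (χ.left.appLE ⊤ ⊤ le_top) h1).trans ?_
  rw [coe_torusUnit]
  have h4 : χ.left.appLE ⊤ ⊤ le_top = χ.left.appTop := Scheme.Hom.appLE_eq_app _
  rw [h4]
  exact appTop_appTop _ _ _

/-- Over an affine open `V ⊆ U`, the functions on `p⁻¹(V)` are the Laurent polynomials in the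
coordinates over the ring of functions on `V`. -/
lemma Trivialization.laurentEval_bijective (φ : Trivialization n p U) {V : X.left.Opens}
    (hV : V ≤ U) (hVa : IsAffineOpen V) :
    Function.Bijective (laurentEval (p.left.app V).hom fun i =>
      resUnits P.left (p.left.preimage_mono hV) (φ.coordinate i)) := by
  have hpb := isPullback_restrict φ.isPullback hV
  have hle := le_preimage_of_isPullback hpb
  have hbij := appLE_bijective_of_isPullback hpb
  have : IsAffine (opn X V).left := hVa
  have hpo := isPushout_torus n (opn X V)
  have hpo' := hpo.of_iso (Iso.refl _) (Iso.refl _) V.topIso (Iso.refl _)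
    (f' := CommRingCat.ofHom (algebraMap ℂ (Laurent n)))
    (g' := ((Scheme.ΓSpecIso (.of ℂ)).inv ≫ (opn X V).hom.appTop) ≫ V.topIso.hom)
    (inl' := (Scheme.ΓSpecIso (.of (Laurent n))).inv ≫ (fst (Torus n) (opn X V)).left.appTop)
    (inr' := V.topIso.inv ≫ (snd (Torus n) (opn X V)).left.appTop)
    ((Category.comp_id _).trans (Category.id_comp _).symm) (Category.id_comp _).symm
    ((Category.comp_id _).trans (Category.id_comp _).symm)
    ((Category.comp_id _).trans (Iso.hom_inv_id_assoc _ _).symm)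
  have h1 := laurentEval_bijective_of_isPushout hpo'
  have h2 : (fun q => ((Torus n ◁ opnIncl X hV) ≫ φ.hom).left.appLE (p.left ⁻¹ᵁ V) ⊤ hle
      (laurentEval (p.left.app V).hom (fun i =>
        resUnits P.left (p.left.preimage_mono hV) (φ.coordinate i)) q)) =
      laurentEval (V.topIso.inv ≫ (snd (Torus n) (opn X V)).left.appTop).hom
        (torusUnit n (opn X V)) := by
    funext q
    refine (map_laurentEval _ _ _ _).trans ?_
    have e1 := congrArg CommRingCat.Hom.hom (app_comp_appLE_of_isPullback hpb)
    rw [CommRingCat.hom_comp] at e1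
    rw [e1]
    congr 2
    funext i
    refine Units.ext ?_
    refine (φ.appLE_coordinate hV (Torus n ◁ opnIncl X hV) hle i).trans ?_
    rw [whiskerLeft_fst, coe_torusUnit]
  rw [← Function.Bijective.of_comp_iff' hbij]
  exact (congrArg Function.Bijective h2).mpr h1

lemma Trivialization.isAffineOpen_preimage (φ : Trivialization n p U) {V : X.left.Opens}
    (hV : V ≤ U) (hVa : IsAffineOpen V) : IsAffineOpen (p.left ⁻¹ᵁ V) := by
  have hpb := isPullback_restrict φ.isPullback hV
  have := isOpenImmersion_of_isPullback (isPullback_left hpb)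
  have : IsAffine (opn X V).left := hVa
  have := isAffine_torus_tensor n (opn X V)
  rw [← opensRange_of_isPullback (isPullback_left hpb)]
  exact isAffineOpen_opensRange _

/-- The coordinates of two trivializations differ by the transition functions. -/
lemma IsTransition.resUnits_coordinate {V : X.left.Opens} {φ : Trivialization n p U}
    {ψ : Trivialization n p V} {h : opn X (U ⊓ V) ⟶ Torus n} (H : IsTransition φ ψ h) {i : Fin n}
    {g : Γ(X.left, U ⊓ V)ˣ} (hg : coordFun h i = g.1) :
    resUnits P.left (p.left.preimage_mono (inf_le_left : U ⊓ V ≤ U)) (φ.coordinate i) =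
      resUnits P.left (p.left.preimage_mono (inf_le_right : U ⊓ V ≤ V)) (ψ.coordinate i) *
        pullUnits p.left (U := U ⊓ V) (V := p.left ⁻¹ᵁ (U ⊓ V)) le_rfl g := by
  have hpb := isPullback_restrict ψ.isPullback (inf_le_right : U ⊓ V ≤ V)
  have hle := le_preimage_of_isPullback hpb
  refine Units.ext ((appLE_bijective_of_isPullback hpb).1 ?_)
  rw [Units.val_mul]
  refine Eq.trans ?_ (map_mul _ _ _).symm
  have e1 := ψ.appLE_coordinate (inf_le_right : U ⊓ V ≤ V) (Torus n ◁ opnIncl X inf_le_right) hle i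
  have e2 : ((Torus n ◁ opnIncl X inf_le_right) ≫ ψ.hom).left.appLE (p.left ⁻¹ᵁ (U ⊓ V)) ⊤ hle
      (pullUnits p.left (U := U ⊓ V) (V := p.left ⁻¹ᵁ (U ⊓ V)) le_rfl g : _) =
      (snd (Torus n) (opn X (U ⊓ V)) ≫ h).left.appTop (Torus.coord n i) := by
    have := congr($(app_comp_appLE_of_isPullback hpb) (g : Γ(X.left, U ⊓ V)))
    refine Eq.trans ?_ (this.trans ?_)
    · change _ = ((Torus n ◁ opnIncl X inf_le_right) ≫ ψ.hom).left.appLE _ _ _ (p.left.app _ _)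
      rw [Scheme.Hom.app_eq_appLE]
      rfl
    · rw [← hg]
      change (snd (Torus n) (opn X (U ⊓ V))).left.appTop ((U ⊓ V).topIso.inv ((U ⊓ V).topIso.hom
        (h.left.appTop (Torus.coord n i)))) = _
      have h0 : (U ⊓ V).topIso.inv ((U ⊓ V).topIso.hom (h.left.appTop (Torus.coord n i))) =
          h.left.appTop (Torus.coord n i) :=
        congr($((U ⊓ V).topIso.hom_inv_id) (h.left.appTop (Torus.coord n i)))
      exact (congrArg _ h0).trans (appTop_appTop _ _ _)
  have e3 : ((Torus n ◁ opnIncl X inf_le_right) ≫ ψ.hom).left.appLE (p.left ⁻¹ᵁ (U ⊓ V)) ⊤ hle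
      (resUnits P.left (p.left.preimage_mono (inf_le_left : U ⊓ V ≤ U)) (φ.coordinate i) : _) =
      (((Torus n ◁ h) ≫ μ[Torus n])).left.appTop (Torus.coord n i) := by
    have hH : _ = _ := H
    have hle' := hle
    rw [hH] at hle'
    have := φ.appLE_coordinate (inf_le_left : U ⊓ V ≤ U) _ hle' i
    rw [lift_fst] at this
    rw [← this]
    congr 3
    exact congrArg (fun f => f.left) hH
  rw [e1, e2, e3, whiskerLeft_fst]
  have e4 := congrArg (Torus n ◁ h).left.appTop (comul_coord n i)
  rw [map_mul, appTop_appTop, appTop_appTop, appTop_appTop, ← Over.comp_left, ← Over.comp_left,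
    ← Over.comp_left, whiskerLeft_fst, whiskerLeft_snd] at e4
  exact e4

end Coordinates

/-! ### Integrality of the total space -/

section Integrality

lemma exists_isAffineOpen_le {X : Scheme.{u}} {x : X} {U : X.Opens} (hx : x ∈ U) :
    ∃ V : X.Opens, x ∈ V ∧ V ≤ U ∧ IsAffineOpen V := by
  obtain ⟨_, ⟨V, hV, rfl⟩, hxV, hVU⟩ := X.isBasis_affineOpens.exists_subset_of_mem_open hx U.isOpen
  exact ⟨V, hxV, hVU, hV⟩

variable {X P : Scheme.{u}} [IsIntegral X] (p : P ⟶ X) (U : X → X.Opens) (hU : ∀ x, x ∈ U x)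
  (h : ∀ x (V : X.Opens), V ≤ U x → IsAffineOpen V → (∃ v, v ∈ V) → IsIntegral (p ⁻¹ᵁ V).toScheme)
include hU h

/-- A scheme over an integral scheme is integral if this is true for the inverse images of the
members of a basis of the topology. -/
lemma isIntegral_of_forall_preimage : IsIntegral P := by
  have hpt : ∀ z : P, ∃ V : X.Opens, p z ∈ V ∧ V ≤ U (p z) ∧ IsAffineOpen V := fun z =>
    exists_isAffineOpen_le (hU (p z))
  have hred : IsReduced P := by
    choose V hV using hpt
    have hcov : TopologicalSpace.IsOpenCover fun z => p ⁻¹ᵁ V z :=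
      eq_top_iff.mpr fun z _ => TopologicalSpace.Opens.mem_iSup.mpr ⟨z, (hV z).1⟩
    have : ∀ z, IsReduced (p ⁻¹ᵁ V z).toScheme := fun z =>
      have := h _ (V z) (hV z).2.1 (hV z).2.2 ⟨_, (hV z).1⟩
      inferInstance
    have : ∀ i, IsReduced ((P.openCoverOfIsOpenCover _ hcov).X i) := this
    exact IsReduced.of_openCover P (P.openCoverOfIsOpenCover _ hcov)
  have hirr : ∀ x (V : X.Opens), V ≤ U x → IsAffineOpen V → (∃ v, v ∈ V) →
      IsIrreducible (p ⁻¹ᵁ V : Set P) := fun x V hVU hV hv => by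
    have := h x V hVU hV hv
    have : IrreducibleSpace (p ⁻¹ᵁ V : Set P) :=
      inferInstanceAs (IrreducibleSpace (p ⁻¹ᵁ V).toScheme)
    exact isIrreducible_iff_irreducibleSpace.mpr this
  have hpre : IsPreirreducible (Set.univ : Set P) := by
    rintro A B hA hB ⟨a, -, ha⟩ ⟨b, -, hb⟩
    obtain ⟨V, haV, hVU, hV⟩ := hpt a
    obtain ⟨W, hbW, hWU, hW⟩ := hpt b
    have hg : genericPoint X ∈ V ⊓ W := ⟨generic_mem haV, generic_mem hbW⟩
    obtain ⟨T, hgT, hTVW, hT⟩ := exists_isAffineOpen_le hg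
    -- `p⁻¹(T)` is irreducible and meets both `A` and `B`
    have h1 := hirr _ T ((hTVW.trans inf_le_left).trans hVU) hT ⟨_, hgT⟩
    obtain ⟨z, hz⟩ := h1.nonempty
    obtain ⟨a', -, ha', haT⟩ := (hirr _ V hVU hV ⟨_, haV⟩).2 A _ hA (p ⁻¹ᵁ T).isOpen ⟨a, haV, ha⟩
      ⟨z, (hTVW hz).1, hz⟩
    obtain ⟨b', -, hb', hbT⟩ := (hirr _ W hWU hW ⟨_, hbW⟩).2 B _ hB (p ⁻¹ᵁ T).isOpen ⟨b, hbW, hb⟩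
      ⟨z, (hTVW hz).2, hz⟩
    obtain ⟨w, -, hw⟩ := h1.2 A B hA hB ⟨a', haT, ha'⟩ ⟨b', hbT, hb'⟩
    exact ⟨w, trivial, hw⟩
  have hne : Nonempty P := by
    obtain ⟨V, hx, hVU, hV⟩ := exists_isAffineOpen_le (hU (genericPoint X))
    obtain ⟨z, -⟩ := (hirr _ V hVU hV ⟨_, hx⟩).nonempty
    exact ⟨z⟩
  have : IrreducibleSpace P :=
    { isPreirreducible_univ := hpre, toNonempty := hne }
  exact isIntegral_of_irreducibleSpace_of_isReduced P

lemma map_genericPoint_of_forall_preimage [IsIntegral P] :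
    p (genericPoint P) = genericPoint X := by
  have key : ∀ W : X.Opens, (∃ w, w ∈ W) → p (genericPoint P) ∈ W := by
    rintro W ⟨w, hw⟩
    obtain ⟨V, hgV, hVW, hV⟩ := exists_isAffineOpen_le (U := W ⊓ U w)
      ⟨generic_mem hw, generic_mem (hU w)⟩
    have := h w V (hVW.trans inf_le_right) hV ⟨_, hgV⟩
    obtain ⟨z⟩ : Nonempty (p ⁻¹ᵁ V).toScheme := inferInstance
    have h1 : genericPoint P ∈ p ⁻¹ᵁ V := generic_mem z.2
    exact (hVW h1).1
  refine IsGenericPoint.eq (S := Set.univ) ?_ (genericPoint_spec X)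
  rw [isGenericPoint_iff_specializes]
  refine fun y => ⟨fun _ => trivial, fun _ => specializes_iff_forall_open.mpr fun W hW hy => ?_⟩
  exact key ⟨W, hW⟩ ⟨y, hy⟩

end Integrality

/-! ### The torus atlas of a bundle -/

section ChartOfTrivialization

variable {n : ℕ} {X P : SchC} [ModObj (Torus n) P] {p : P ⟶ X} {U : X.left.Opens}

lemma Trivialization.isIntegral_preimage [IsIntegral X.left] (φ : Trivialization n p U)
    {V : X.left.Opens} (hV : V ≤ U) (hVa : IsAffineOpen V) (hv : ∃ v, v ∈ V) :
    IsIntegral (p.left ⁻¹ᵁ V).toScheme := by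
  obtain ⟨v, hv⟩ := hv
  have : Nonempty V := ⟨⟨v, hv⟩⟩
  have h1 : IsDomain (AddMonoidAlgebra Γ(X.left, V) (Fin n → ℤ)) := NoZeroDivisors.to_isDomain _
  have h2 : IsDomain Γ(P.left, p.left ⁻¹ᵁ V) :=
    (RingEquiv.ofBijective _ (φ.laurentEval_bijective hV hVa)).symm.toMulEquiv.isDomain _
  have h3 : IsDomain Γ((p.left ⁻¹ᵁ V).toScheme, ⊤) :=
    (p.left ⁻¹ᵁ V).topIso.commRingCatIsoToRingEquiv.toMulEquiv.isDomain _
  have h4 : IsAffine (p.left ⁻¹ᵁ V).toScheme := φ.isAffineOpen_preimage hV hVa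
  have h5 : Nonempty (p.left ⁻¹ᵁ V).toScheme := by
    by_contra hne
    rw [not_nonempty_iff] at hne
    exact not_subsingleton Γ((p.left ⁻¹ᵁ V).toScheme, ⊤) inferInstance
  exact isIntegral_of_isAffine_of_isDomain _

lemma generic_mem_preimage {X P : Scheme.{u}} [IsIntegral X] [IsIntegral P] {p : P ⟶ X}
    (hp : p (genericPoint P) = genericPoint X) {V : X.Opens} (hV : genericPoint X ∈ V) :
    genericPoint P ∈ p ⁻¹ᵁ V := by
  change p (genericPoint P) ∈ V
  rwa [hp]

variable [IsIntegral X.left] [IsIntegral P.left]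
  (hp : p.left (genericPoint P.left) = genericPoint X.left)

/-- The coordinates of a trivialization, as rational functions. -/
def Trivialization.rationalCoordinate (φ : Trivialization n p U) (hU : genericPoint X.left ∈ U)
    (i : Fin n) : (P.left.functionField)ˣ :=
  unitGerm (p.left ⁻¹ᵁ U) (generic_mem_preimage hp hU) (φ.coordinate i)

lemma Trivialization.laurentEval_toFF (φ : Trivialization n p U) (hU : genericPoint X.left ∈ U)
    {V : X.left.Opens} (hV : V ≤ U) (hgV : genericPoint X.left ∈ V)
    (q : AddMonoidAlgebra Γ(X.left, V) (Fin n → ℤ)) :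
    laurentEval (pullFF p.left hp) (φ.rationalCoordinate hp hU)
        (AddMonoidAlgebra.mapRingHom _ (toFF V hgV) q) =
      toFF (p.left ⁻¹ᵁ V) (generic_mem_preimage hp hgV) (laurentEval (p.left.app V).hom (fun i =>
        resUnits P.left (p.left.preimage_mono hV) (φ.coordinate i)) q) := by
  rw [laurentEval_mapRingHom, map_laurentEval]
  congr 2
  · refine RingHom.ext fun s => ?_
    refine (pullFF_toFF p.left hp hgV (generic_mem_preimage hp hgV) le_rfl s).trans ?_
    rw [← Scheme.Hom.app_eq_appLE]
    rfl
  · funext i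
    exact (unitGerm_resUnits (generic_mem_preimage hp hU) (generic_mem_preimage hp hgV)
      (p.left.preimage_mono hV) (φ.coordinate i)).symm

lemma Trivialization.isTorusChart (φ : Trivialization n p U) (hU : genericPoint X.left ∈ U) :
    IsTorusChart p.left hp U (φ.rationalCoordinate hp hU) where
  generic_mem := hU
  mem_unitsAt y hy i := unitGerm_mem_unitsAt _ (U := p.left ⁻¹ᵁ U) hy _
  injective := by
    rw [injective_iff_map_eq_zero]
    intro q hq
    obtain ⟨V, hgV, hVU, hV⟩ := exists_isAffineOpen_le hU
    have : Nonempty V := ⟨⟨_, hgV⟩⟩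
    have hfrac : IsFractionRing Γ(X.left, V) X.left.functionField :=
      functionField_isFractionRing_of_isAffineOpen X.left V hV
    -- clear the denominators of the coefficients
    obtain ⟨b, hb⟩ := IsLocalization.exist_integer_multiples
      (nonZeroDivisors Γ(X.left, V)) q.coeff.support q.coeff
    have hb0 : toFF V hgV b ≠ 0 := (map_ne_zero_iff _ (toFF_injective V hgV)).mpr
      (nonZeroDivisors.coe_ne_zero b)
    choose! a ha using hb
    let q₀ : AddMonoidAlgebra Γ(X.left, V) (Fin n → ℤ) := ∑ m ∈ q.coeff.support, .single m (a m)
    have hq₀ : AddMonoidAlgebra.mapRingHom _ (toFF V hgV) q₀ = toFF V hgV b • q := by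
      conv_rhs => rw [← AddMonoidAlgebra.sum_coeff_single q, Finsupp.sum, Finset.smul_sum]
      rw [map_sum]
      refine Finset.sum_congr rfl fun m hm => ?_
      have h1 : toFF V hgV (a m) = toFF V hgV b * q.coeff m :=
        (ha m hm).trans (Algebra.smul_def _ _)
      rw [AddMonoidAlgebra.smul_single, smul_eq_mul, ← h1]
      ext
      simp
    have h0 := φ.laurentEval_toFF hp hU hVU hgV q₀
    rw [hq₀, laurentEval_smul, hq, mul_zero, eq_comm,
      map_eq_zero_iff _ (toFF_injective _ _),
      map_eq_zero_iff _ (φ.laurentEval_bijective hVU hV).1] at h0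
    rw [h0, map_zero, eq_comm, smul_eq_zero] at hq₀
    exact hq₀.resolve_left hb0
  isAffineOpen V hVU hV := φ.isAffineOpen_preimage hVU hV
  exists_laurent V hVU hV hgV f hf := by
    obtain ⟨s, rfl⟩ := exists_toFF_eq (generic_mem_preimage hp hgV) hf
    obtain ⟨q, rfl⟩ := (φ.laurentEval_bijective hVU hV).2 s
    refine ⟨AddMonoidAlgebra.mapRingHom _ (toFF V hgV) q, φ.laurentEval_toFF hp hU hVU hgV q,
      fun m v hv => ?_⟩
    have : (AddMonoidAlgebra.mapRingHom (Fin n → ℤ) (toFF V hgV) q).coeff m =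
        toFF V hgV (q.coeff m) := by simp
    rw [this]
    exact toFF_mem_regAt hgV hv _

/-- The coordinates of trivializations over the members of a cover, with transition functions
given by cocycles `gᵢ`, form a torus atlas whose divisors are those given by `gᵢ`. -/
lemma isTorusAtlas {𝒰 : PtCover X.left} (φ : ∀ x, Trivialization n p (𝒰.opens x))
    {g : Fin n → Z1 𝒰} (hφ : ∀ x y, ∃ h : opn X (𝒰.opens x ⊓ 𝒰.opens y) ⟶ Torus n,
      IsTransition (φ x) (φ y) h ∧ ∀ i, coordFun h i = ((g i).1 x y).1)
    {G : Fin n → X.left → (X.left.functionField)ˣ} (hG : ∀ i, Represents (g i) (G i)) :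
    IsTorusAtlas p.left hp 𝒰.opens
      (fun x => (φ x).rationalCoordinate hp (𝒰.generic_mem x)) G where
  mem := 𝒰.mem
  chart x := (φ x).isTorusChart hp (𝒰.generic_mem x)
  transition x y i := by
    obtain ⟨h, ht, hh⟩ := hφ x y
    have hg := generic_mem_preimage hp (𝒰.generic_mem₂ x y)
    have h1 := congrArg (unitGerm (p.left ⁻¹ᵁ (𝒰.opens x ⊓ 𝒰.opens y)) hg)
      (ht.resUnits_coordinate (hh i))
    rw [map_mul, unitGerm_resUnits (generic_mem_preimage hp (𝒰.generic_mem x)),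
      unitGerm_resUnits (generic_mem_preimage hp (𝒰.generic_mem y))] at h1
    refine h1.trans (congrArg _ ?_)
    rw [← hG i x y]
    exact Units.ext (pullFF_toFF p.left hp (𝒰.generic_mem₂ x y) hg le_rfl _).symm

end ChartOfTrivialization

end TorusBundle

end

theorem mainTheorem9 (X : TorusBundle.SchC) (hX : TorusBundle.IsNormalVariety X) (n : ℕ)
    (c : Fin n → TorusBundle.H1 X.left)
    (P : TorusBundle.SchC) [ModObj (TorusBundle.Torus n) P] (p : P ⟶ X)
    (hp : TorusBundle.IsPrincipalBundle n p) (hc : TorusBundle.HasClass p c) :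
    ∃ e : (TorusBundle.H1 X.left ⧸ Subgroup.closure (Set.range c)) ≃* TorusBundle.H1 P.left,
      ∀ a : TorusBundle.H1 X.left,
        e (QuotientGroup.mk a) = TorusBundle.H1.pullback p.left a := by
  obtain ⟨𝒰, φ, g, hφ, hgc⟩ := hc
  have := hX.isIntegral
  have hint := fun x (V : X.left.Opens) (hV : V ≤ 𝒰.opens x) => (φ x).isIntegral_preimage hV
  have := TorusBundle.isIntegral_of_forall_preimage p.left 𝒰.opens 𝒰.mem hint
  have hgen := TorusBundle.map_genericPoint_of_forall_preimage p.left 𝒰.opens 𝒰.mem hint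
  have hG := fun i => TorusBundle.represents_self (g i) (genericPoint X.left)
  exact (TorusBundle.isTorusAtlas hgen φ hφ hG).exists_mulEquiv hX.isIntegrallyClosed
    fun i => ⟨𝒰, g i, hgc i, hG i⟩
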